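/- Let $k$ be an algebraically closed field (of any characteristic) and let $X$ be a scheme of finite type over $k$. For $m\in\mathbb{N}=\{0,1,2,\dots\}$ let $X_m$ denote the $m$-jet scheme of $X$, i.e. the $k$-scheme representing the functor $$Z\longmapsto \operatorname{Hom}_k\bigl(Z\times_{\operatorname{Spec}k}\operatorname{Spec}k[t]/(t^{m+1}),\,X\bigr)$$ on $k$-schemes $Z$. A $k$-scheme $Y$ is called locally a complete intersection if every point $y\in Y$ has an open neighbourhood $U$ with a closed immersion $U\hookrightarrow\mathbb{A}^N_k$ over $k$, for some $N$, such that the kernel of $\mathcal{O}_{\mathbb{A}^N_k,y}\to\mathcal{O}_{U,y}$ is generated by $c=\dim\mathcal{O}_{\mathbb{A}^N_k,y}-\dim\mathcal{O}_{U,y}$ elements. **Theorem.** If $X_m$ is locally a complete intersection for some $m\in\mathbb{N}$, then $X$ is locally a complete intersection. -/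

import Mathlib

universe u

open CategoryTheory AlgebraicGeometry

/-! ### Representability of `Z ↦ Hom_S(Z ×_S D, X)`

The facts in this part show that for `S = Spec R` and `D = Spec E`, with `E` a finite free
`R`-algebra that is a nilpotent thickening of `R`, the functor `Z ↦ Hom_S(Z ×_S D, X)` on
`S`-schemes is representable for every `S`-scheme `X`. This is used to define jet schemes. -/

namespace JetScheme

open CategoryTheory.Limits

/-- For a morphism `p : D ⟶ S`, the functor `Z ↦ Z ×_S D` on `S`-schemes. -/
noncomputable def prodFunctor {S D : Scheme.{u}} (p : D ⟶ S) : Over S ⥤ Over S :=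
  Over.pullback p ⋙ Over.map p

section General

variable {S D : Scheme.{u}} (p : D ⟶ S)

/-- The projection `Z ×_S D ⟶ Z`. -/
noncomputable def fst (Z : Over S) : ((prodFunctor p).obj Z).left ⟶ Z.left :=
  pullback.fst Z.hom p

/-- The projection `Z ×_S D ⟶ D`. -/
noncomputable def snd (Z : Over S) : ((prodFunctor p).obj Z).left ⟶ D :=
  pullback.snd Z.hom p

lemma isPullback (Z : Over S) : IsPullback (fst p Z) (snd p Z) Z.hom p :=
  IsPullback.of_hasPullback Z.hom p

lemma snd_comp (Z : Over S) : snd p Z ≫ p = ((prodFunctor p).obj Z).hom := rfl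

lemma fst_comp (Z : Over S) : fst p Z ≫ Z.hom = ((prodFunctor p).obj Z).hom :=
  (isPullback p Z).w

@[simp]
lemma map_fst {Z W : Over S} (h : Z ⟶ W) :
    ((prodFunctor p).map h).left ≫ fst p W = fst p Z ≫ h.left :=
  pullback.lift_fst _ _ _

@[simp]
lemma map_fst_assoc {Z W : Over S} (h : Z ⟶ W) {T : Scheme.{u}} (a : W.left ⟶ T) :
    ((prodFunctor p).map h).left ≫ fst p W ≫ a = fst p Z ≫ h.left ≫ a := by
  rw [← Category.assoc, map_fst, Category.assoc]

@[simp]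
lemma map_snd {Z W : Over S} (h : Z ⟶ W) :
    ((prodFunctor p).map h).left ≫ snd p W = snd p Z :=
  pullback.lift_snd _ _ _

@[simp]
lemma map_snd_assoc {Z W : Over S} (h : Z ⟶ W) {T : Scheme.{u}} (a : D ⟶ T) :
    ((prodFunctor p).map h).left ≫ snd p W ≫ a = snd p Z ≫ a := by
  rw [← Category.assoc, map_snd]

lemma isPullback_map {Z W : Over S} (h : Z ⟶ W) :
    IsPullback ((prodFunctor p).map h).left (fst p Z) (fst p W) h.left := by
  refine IsPullback.of_right (h₁₂ := snd p W) (h₂₂ := W.hom) (v₁₃ := p) ?_ (by simp)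
    (isPullback p W).flip
  simpa using (isPullback p Z).flip

variable {p} (e : S ⟶ D) (he : e ≫ p = 𝟙 S)

/-- The section `Z ⟶ Z ×_S D` of the projection induced by a section `e` of `p`. -/
noncomputable def zeroSec (Z : Over S) : Z ⟶ (prodFunctor p).obj Z :=
  Over.homMk ((isPullback p Z).lift (𝟙 _) (Z.hom ≫ e) (by simp [he])) (by
    simp [← snd_comp, he])

@[simp]
lemma zeroSec_fst (Z : Over S) : (zeroSec e he Z).left ≫ fst p Z = 𝟙 _ := by
  simp [zeroSec]

@[simp]
lemma zeroSec_fst_assoc (Z : Over S) {T : Scheme.{u}} (a : Z.left ⟶ T) :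
    (zeroSec e he Z).left ≫ fst p Z ≫ a = a := by
  rw [← Category.assoc, zeroSec_fst, Category.id_comp]

@[simp]
lemma zeroSec_snd (Z : Over S) : (zeroSec e he Z).left ≫ snd p Z = Z.hom ≫ e := by
  simp [zeroSec]

lemma zeroSec_naturality {Z W : Over S} (h : Z ⟶ W) :
    h ≫ zeroSec e he W = zeroSec e he Z ≫ (prodFunctor p).map h := by
  ext1
  apply (isPullback p W).hom_ext
  · simp
  · simp

lemma zeroSec_naturality_assoc {Z W T : Over S} (h : Z ⟶ W) (g : (prodFunctor p).obj W ⟶ T) :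
    h ≫ zeroSec e he W ≫ g = zeroSec e he Z ≫ (prodFunctor p).map h ≫ g := by
  rw [← Category.assoc, zeroSec_naturality, Category.assoc]

lemma zeroSec_surjective [Surjective e] (Z : Over S) : Surjective (zeroSec e he Z).left := by
  have : IsPullback (zeroSec e he Z).left Z.hom (snd p Z) e := by
    refine IsPullback.of_right (h₁₂ := fst p Z) (h₂₂ := p) (v₁₃ := Z.hom) ?_ (by simp)
      (isPullback p Z)
    rw [zeroSec_fst, he]
    exact IsPullback.of_horiz_isIso ⟨by simp⟩
  exact MorphismProperty.of_isPullback this.flip inferInstance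

/-- `L : Y ×_S D ⟶ X` is a universal family: every family `g : Z ×_S D ⟶ X` is the pullback of `L`
along a unique `S`-morphism `Z ⟶ Y`. -/
def IsUniversal {X Y : Over S} (L : (prodFunctor p).obj Y ⟶ X) : Prop :=
  ∀ (Z : Over S) (g : (prodFunctor p).obj Z ⟶ X), ∃! h : Z ⟶ Y, (prodFunctor p).map h ≫ L = g

lemma IsUniversal.isRepresentable {X Y : Over S} {L : (prodFunctor p).obj Y ⟶ X}
    (hL : IsUniversal L) : ((prodFunctor p).op ⋙ yoneda.obj X).IsRepresentable :=
  ⟨Y, ⟨{ homEquiv := fun {Z} => Equiv.ofBijective (fun h => (prodFunctor p).map h ≫ L)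
          ⟨fun a b hab => (hL Z _).unique hab rfl, fun g => (hL Z g).exists⟩
         homEquiv_comp := fun f g => by
          change (prodFunctor p).map (f ≫ g) ≫ L = (prodFunctor p).map f ≫ (prodFunctor p).map g ≫ L
          simp }⟩⟩

lemma IsUniversal.comp_iso {X X' Y : Over S} {L : (prodFunctor p).obj Y ⟶ X}
    (hL : IsUniversal L) (i : X ≅ X') : IsUniversal (L ≫ i.hom) := by
  intro Z g
  simpa only [Iso.eq_comp_inv, Category.assoc] using hL Z (g ≫ i.inv)

/-- If `U` is an open cover of `Z`, then the `Uᵢ ×_S D` jointly cover `Z ×_S D`. -/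
lemma hom_ext_of_cover {Z : Over S} {T : Scheme.{u}} (U : Z.left.OpenCover)
    (a b : ((prodFunctor p).obj Z).left ⟶ T)
    (h : ∀ i, ((prodFunctor p).map (Over.homMk (U := Over.mk (U.f i ≫ Z.hom)) (U.f i))).left ≫ a =
      ((prodFunctor p).map (Over.homMk (U := Over.mk (U.f i ≫ Z.hom)) (U.f i))).left ≫ b) :
    a = b := by
  apply (U.pullback₁ (fst p Z)).hom_ext
  intro i
  have := (isPullback_map p (Over.homMk (U := Over.mk (U.f i ≫ Z.hom)) (V := Z) (U.f i)))
  have h2 : pullback.fst (fst p Z) (U.f i) = (this.isoPullback).inv ≫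
      ((prodFunctor p).map (Over.homMk (U := Over.mk (U.f i ≫ Z.hom)) (U.f i))).left := by
    exact this.isoPullback_inv_fst.symm
  change pullback.fst (fst p Z) (U.f i) ≫ a = pullback.fst (fst p Z) (U.f i) ≫ b
  rw [h2]
  exact (Category.assoc _ _ _).trans ((congrArg _ (h i)).trans (Category.assoc _ _ _).symm)

/-- At most one morphism induces a given family. -/
def AtMostOne {X Y : Over S} (L : (prodFunctor p).obj Y ⟶ X) : Prop :=
  ∀ (Z : Over S) (h₁ h₂ : Z ⟶ Y), (prodFunctor p).map h₁ ≫ L = (prodFunctor p).map h₂ ≫ L → h₁ = h₂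

lemma atMostOne_of_cover {X Y : Over S} {L : (prodFunctor p).obj Y ⟶ X}
    (H : ∀ (Z : Over S) (h₁ h₂ : Z ⟶ Y), (prodFunctor p).map h₁ ≫ L = (prodFunctor p).map h₂ ≫ L →
      ∃ U : Scheme.OpenCover.{u} Z.left, ∀ i, U.f i ≫ h₁.left = U.f i ≫ h₂.left) : AtMostOne L := by
  intro Z h₁ h₂ h
  obtain ⟨U, hU⟩ := H Z h₁ h₂ h
  ext1
  exact U.hom_ext _ _ hU

lemma isUniversal_of_cover {X Y : Over S} {L : (prodFunctor p).obj Y ⟶ X} (h1 : AtMostOne L)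
    (H : ∀ (Z : Over S) (g : (prodFunctor p).obj Z ⟶ X), ∃ U : Scheme.OpenCover.{u} Z.left, ∀ i,
      ∃ h : Over.mk (U.f i ≫ Z.hom) ⟶ Y, 
      (prodFunctor p).map h ≫ L = (prodFunctor p).map (Over.homMk (U.f i)) ≫ g) :
    IsUniversal L := by
  intro Z g
  obtain ⟨U, hU⟩ := H Z g
  choose h hh using hU
  have key : ∃ q : Z.left ⟶ Y.left, ∀ i, U.f i ≫ q = (h i).left := by
    refine ⟨U.glueMorphisms (fun i => (h i).left) ?_, fun i => U.ι_glueMorphisms _ _ i⟩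
    intro i j
    let W : Over S := Over.mk (pullback.fst (U.f i) (U.f j) ≫ U.f i ≫ Z.hom)
    let a : W ⟶ Over.mk (U.f i ≫ Z.hom) := Over.homMk (pullback.fst (U.f i) (U.f j))
    let b : W ⟶ Over.mk (U.f j ≫ Z.hom) := Over.homMk (pullback.snd (U.f i) (U.f j)) (by
      simp [W, pullback.condition_assoc])
    have hab : a ≫ Over.homMk (V := Z) (U.f i) = b ≫ Over.homMk (V := Z) (U.f j) := by
      ext1
      simp [a, b, pullback.condition]
    have : a ≫ h i = b ≫ h j := by
      apply h1
      rw [Functor.map_comp, Functor.map_comp, Category.assoc, Category.assoc, hh, hh,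
        ← Functor.map_comp_assoc, ← Functor.map_comp_assoc, hab]
    exact congr(($this).left)
  obtain ⟨q, hq⟩ := key
  let q' : Z ⟶ Y := Over.homMk q (by
    apply U.hom_ext
    intro i
    rw [← Category.assoc, hq]
    simp)
  have hq' : (prodFunctor p).map q' ≫ L = g := by
    ext1
    apply hom_ext_of_cover U
    intro i
    have e1 : (Over.homMk (U.f i) : Over.mk (U.f i ≫ Z.hom) ⟶ Z) ≫ q' = h i := by
      ext1; simp [q', hq]
    have := hh i
    rw [← e1, Functor.map_comp, Category.assoc] at this
    exact congr(($this).left)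
  exact ⟨q', hq', fun y hy => h1 _ _ _ (hy.trans hq'.symm)⟩

lemma exists_lift [Surjective e] {X X' Z : Over S} (j : X' ⟶ X) [IsOpenImmersion j.left]
    (g : (prodFunctor p).obj Z ⟶ X)
    (hg : Set.range (zeroSec e he Z ≫ g).left ⊆ Set.range j.left) : ∃ g', g' ≫ j = g := by
  have : Set.range g.left ⊆ Set.range j.left := by
    rintro _ ⟨y, rfl⟩
    obtain ⟨z, rfl⟩ := (zeroSec_surjective e he Z).surj y
    exact hg ⟨z, by simp⟩
  refine ⟨Over.homMk (IsOpenImmersion.lift j.left g.left this) ?_, ?_⟩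
  · rw [← Over.w g, ← Over.w j, IsOpenImmersion.lift_fac_assoc]
  · ext1
    simp

/-- An open immersion of `S`-schemes cancels on the right. -/
lemma cancel_openImmersion {X X' Z : Over S} (j : X' ⟶ X) [IsOpenImmersion j.left]
    {a b : Z ⟶ X'} (h : a ≫ j = b ≫ j) : a = b := by
  ext1
  rw [← cancel_mono j.left]
  exact congr(($h).left)

lemma isPullback_of_isUniversal [Surjective e] {X X' Y Y' : Over S} (j : X' ⟶ X)
    [IsOpenImmersion j.left]
    {L : (prodFunctor p).obj Y ⟶ X} {L' : (prodFunctor p).obj Y' ⟶ X'}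
    (hL : IsUniversal L) (hL' : IsUniversal L') (t : Y' ⟶ Y)
    (ht : (prodFunctor p).map t ≫ L = L' ≫ j) :
    IsPullback t.left (zeroSec e he Y' ≫ L').left (zeroSec e he Y ≫ L).left j.left := by
  have w : t ≫ zeroSec e he Y ≫ L = (zeroSec e he Y' ≫ L') ≫ j := by
    rw [zeroSec_naturality_assoc, ht, Category.assoc]
  have key (s : PullbackCone (zeroSec e he Y ≫ L).left j.left) :
      ∃ l : s.pt ⟶ Y'.left, l ≫ t.left = s.fst ∧ l ≫ (zeroSec e he Y' ≫ L').left = s.snd ∧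
        ∀ m : s.pt ⟶ Y'.left, m ≫ t.left = s.fst → m = l := by
    let Z : Over S := Over.mk (s.fst ≫ Y.hom)
    let b : Z ⟶ Y := Over.homMk s.fst
    obtain ⟨g', hg'⟩ : ∃ g', g' ≫ j = (prodFunctor p).map b ≫ L := by
      apply exists_lift e he j
      rw [← zeroSec_naturality_assoc]
      have hb : (b ≫ zeroSec e he Y ≫ L).left = s.snd ≫ j.left := s.condition
      rw [hb]
      rintro _ ⟨y, rfl⟩
      exact ⟨s.snd y, by simp⟩
    obtain ⟨l, hl, hl'⟩ := hL' Z g'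
    have h1 : l ≫ t = b := (hL Z ((prodFunctor p).map b ≫ L)).unique
      (by rw [Functor.map_comp, Category.assoc, ht, ← hg', ← hl, Category.assoc]) rfl
    have h1' : l.left ≫ t.left = s.fst := congr(($h1).left)
    refine ⟨l.left, h1', ?_, fun m hm => ?_⟩
    · rw [← cancel_mono j.left, Category.assoc, ← s.condition, ← h1', Category.assoc]
      exact congr(l.left ≫ ($w).left).symm
    · let m' : Z ⟶ Y' := Over.homMk m (by
        rw [← Over.w t, reassoc_of% hm]; rfl)
      have hm : m' ≫ t = b := by ext1; exact hm
      have : m' = l := by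
        apply hl'
        apply cancel_openImmersion j
        rw [hg', Category.assoc, ← ht, ← Functor.map_comp_assoc, hm]
      exact congr(($this).left)
  choose l h1 h2 h3 using key
  exact ⟨⟨congr(($w).left)⟩, ⟨PullbackCone.IsLimit.mk _ l h1 h2 fun s m hm _ => h3 s m hm⟩⟩

lemma exists_glued {X : Scheme.{u}} (U : Scheme.OpenCover.{u} X) [Category.{u} U.I₀]
    [U.LocallyDirected] [Quiver.IsThin U.I₀] (d : Scheme.Cover.RelativeGluingData U) :
    ∃ (G : Scheme.{u}) (b : G ⟶ X) (c : ∀ i, d.functor.obj i ⟶ G),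
      (∀ {i j} (f : i ⟶ j), d.functor.map f ≫ c j = c i) ∧
      ∀ i, IsPullback (d.natTrans.app i) (c i) (U.f i) b :=
  ⟨d.glued, d.toBase, fun i => colimit.ι d.functor i, fun f => colimit.w d.functor f,
    fun i => d.isPullback_natTrans_ι_toBase i⟩

lemma exists_glue_pullback {X : Scheme.{u}} (U : Scheme.OpenCover.{u} X) [Category.{u} U.I₀]
    [U.LocallyDirected] (T A : Over S) (q : T.left ⟶ X) (g : ∀ i, pullback q (U.f i) ⟶ A.left)
    (h : ∀ {i j : U.I₀} (f : i ⟶ j), pullback.map q (U.f i) q (U.f j) (𝟙 _) (U.trans f) (𝟙 _)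
      (by simp) (by simp) ≫ g j = g i) (w : ∀ i, g i ≫ A.hom = pullback.fst _ _ ≫ T.hom) :
    ∃ M : T ⟶ A, ∀ i, pullback.fst q (U.f i) ≫ M.left = g i := by
  have h' {i j : (U.pullback₁ q).I₀} (f : i ⟶ j) :
      Scheme.Cover.trans (U.pullback₁ q) f ≫ g j = g i := h f
  exact ⟨Scheme.OpenCover.glueMorphismsOverOfLocallyDirected (U.pullback₁ q) g h' w,
    fun i => Scheme.OpenCover.map_glueMorphismsOverOfLocallyDirected_left (U.pullback₁ q) g h' w i⟩

lemma exists_isUniversal_of_glued [Surjective e] {X : Over S} (U : Scheme.OpenCover.{u} X.left)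
    [Category.{u} U.I₀] [U.LocallyDirected] (Y : U.I₀ → Over S)
    (L : ∀ i, (prodFunctor p).obj (Y i) ⟶ Over.mk (U.f i ≫ X.hom)) (hL : ∀ i, IsUniversal (L i))
    (Yt : ∀ {i j : U.I₀}, (i ⟶ j) → (Y i ⟶ Y j))
    (tr : ∀ {i j : U.I₀}, (i ⟶ j) → (Over.mk (U.f i ≫ X.hom) ⟶ Over.mk (U.f j ≫ X.hom)))
    (htr : ∀ {i j : U.I₀} (f : i ⟶ j), (tr f).left = U.trans f)
    (hYt : ∀ {i j : U.I₀} (f : i ⟶ j), (prodFunctor p).map (Yt f) ≫ L j = L i ≫ tr f)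
    (G : Scheme.{u}) (b : G ⟶ X.left) (c : ∀ i, (Y i).left ⟶ G)
    (hc : ∀ {i j : U.I₀} (f : i ⟶ j), (Yt f).left ≫ c j = c i)
    (hp : ∀ i, IsPullback (zeroSec e he (Y i) ≫ L i).left (c i) (U.f i) b) :
    ∃ (Y : Over S) (L : (prodFunctor p).obj Y ⟶ X), IsUniversal L := by
  let inc (i : U.I₀) : Over.mk (U.f i ≫ X.hom) ⟶ X := Over.homMk (U.f i)
  have oi2 (i : U.I₀) : IsOpenImmersion (inc i).left :=
    inferInstanceAs (IsOpenImmersion (U.f i))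
  let G' : Over S := Over.mk (b ≫ X.hom)
  let c' (i : U.I₀) : Y i ⟶ G' := Over.homMk (c i) (by
    have := (hp i).w
    change c i ≫ b ≫ X.hom = _
    rw [← reassoc_of% this]
    exact Over.w (zeroSec e he (Y i) ≫ L i))
  have oi3 (i : U.I₀) : IsOpenImmersion (c i) :=
    MorphismProperty.of_isPullback (hp i) inferInstance
  have hpT (i : U.I₀) : IsPullback ((prodFunctor p).map (c' i)).left
      (fst p (Y i) ≫ (zeroSec e he (Y i) ≫ L i).left) (fst p G' ≫ b) (U.f i) :=
    ((isPullback_map p (c' i)).flip.paste_horiz (hp i)).flip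
  obtain ⟨M, hM⟩ : ∃ M : (prodFunctor p).obj G' ⟶ X, ∀ i,
      (prodFunctor p).map (c' i) ≫ M = L i ≫ inc i := by
    let k (i : U.I₀) := (hpT i).isoPullback
    have hk1 (i : U.I₀) : (k i).hom ≫ pullback.fst _ _ = ((prodFunctor p).map (c' i)).left :=
      (hpT i).isoPullback_hom_fst
    have hk2 (i : U.I₀) : (k i).inv ≫ ((prodFunctor p).map (c' i)).left = pullback.fst _ _ :=
      (hpT i).isoPullback_inv_fst
    have hL' (i : U.I₀) : (L i).left ≫ U.f i ≫ X.hom = ((prodFunctor p).obj (Y i)).hom :=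
      Over.w (L i)
    obtain ⟨M, hM⟩ := exists_glue_pullback U ((prodFunctor p).obj G') X (fst p G' ≫ b)
      (fun i => (k i).inv ≫ (L i).left ≫ U.f i) (fun {i j} f => by
        have oi : IsOpenImmersion ((prodFunctor p).map (c' j)).left :=
          MorphismProperty.of_isPullback (isPullback_map p (c' j)).flip (oi3 j)
        have hcc : Yt f ≫ c' j = c' i := by ext1; exact hc f
        have : pullback.map (fst p G' ≫ b) (U.f i) (fst p G' ≫ b) (U.f j) (𝟙 _) (U.trans f) (𝟙 _)
            (by simp) (by simp) ≫ (k j).inv =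
            (k i).inv ≫ ((prodFunctor p).map (Yt f)).left := by
          rw [← cancel_mono ((prodFunctor p).map (c' j)).left, Category.assoc,
            Category.assoc (k i).inv, hk2, ← Over.comp_left, ← Functor.map_comp, hcc, hk2]
          exact (pullback.lift_fst _ _ _).trans (Category.comp_id _)
        have h2 : ((prodFunctor p).map (Yt f)).left ≫ (L j).left = (L i).left ≫ U.trans f := by
          rw [← htr]
          exact congr(($(hYt f)).left)
        rw [reassoc_of% this, reassoc_of% h2, Scheme.Cover.trans_map])
      (fun i => by
        rw [Category.assoc, Category.assoc, hL', ← hk2, Category.assoc, Over.w])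
    refine ⟨M, fun i => ?_⟩
    ext1
    have : (k i).hom ≫ pullback.fst _ _ ≫ M.left = _ := congr((k i).hom ≫ $(hM i))
    rw [reassoc_of% hk1] at this
    simpa [inc] using this
  have hb : (zeroSec e he G' ≫ M).left = b := by
    let V : Scheme.OpenCover.{u} G := U.pullback₁ b
    apply V.hom_ext
    intro (i : U.I₀)
    change pullback.fst b (U.f i) ≫ _ = pullback.fst b (U.f i) ≫ _
    rw [← (hp i).flip.isoPullback_inv_fst, Category.assoc, Category.assoc]
    congr 1
    have : c' i ≫ zeroSec e he G' ≫ M = (zeroSec e he (Y i) ≫ L i) ≫ inc i := by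
      rw [zeroSec_naturality_assoc, hM, Category.assoc]
    exact congr(($this).left).trans (hp i).w
  have hcinc {Z : Over S} (i : U.I₀) (h : Z ⟶ Y i) :
      (prodFunctor p).map (h ≫ c' i) ≫ M = (prodFunctor p).map h ≫ L i ≫ inc i := by
    rw [Functor.map_comp, Category.assoc, hM]
  refine ⟨G', M, isUniversal_of_cover (atMostOne_of_cover fun Z h₁ h₂ h => ?_) fun Z g => ?_⟩
  · have hq : h₁.left ≫ b = h₂.left ≫ b := by
      rw [← hb, ← Over.comp_left, ← Over.comp_left, zeroSec_naturality_assoc, h,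
        zeroSec_naturality_assoc]
    refine ⟨U.pullback₁ (h₁.left ≫ b), fun (i : U.I₀) => ?_⟩
    let Z' : Over S := Over.mk (pullback.fst (h₁.left ≫ b) (U.f i) ≫ Z.hom)
    let j : Z' ⟶ Z := Over.homMk (pullback.fst (h₁.left ≫ b) (U.f i))
    have key (h : Z ⟶ G') (hh : h.left ≫ b = h₁.left ≫ b) : ∃ h' : Z' ⟶ Y i, h' ≫ c' i = j ≫ h := by
      have hw : pullback.snd (h₁.left ≫ b) (U.f i) ≫ U.f i =
          (pullback.fst (h₁.left ≫ b) (U.f i) ≫ h.left) ≫ b := by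
        rw [Category.assoc, hh, pullback.condition]
      let l := (hp i).lift (pullback.snd (h₁.left ≫ b) (U.f i))
        (pullback.fst (h₁.left ≫ b) (U.f i) ≫ h.left) hw
      have hl : l ≫ c i = pullback.fst (h₁.left ≫ b) (U.f i) ≫ h.left := (hp i).lift_snd _ _ _
      refine ⟨Over.homMk l ?_, by ext1; exact hl⟩
      rw [← Over.w (c' i)]
      change l ≫ c i ≫ G'.hom = pullback.fst (h₁.left ≫ b) (U.f i) ≫ Z.hom
      rw [reassoc_of% hl, Over.w h]
    obtain ⟨a₁, ha₁⟩ := key h₁ rfl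
    obtain ⟨a₂, ha₂⟩ := key h₂ hq.symm
    have : a₁ = a₂ := by
      refine (hL i _ ((prodFunctor p).map a₂ ≫ L i)).unique ?_ rfl
      have := oi2 i
      apply cancel_openImmersion (inc i)
      rw [Category.assoc, Category.assoc, ← hcinc, ← hcinc, ha₁, ha₂, Functor.map_comp,
        Functor.map_comp, Category.assoc, Category.assoc, h]
    have : j ≫ h₁ = j ≫ h₂ := by rw [← ha₁, ← ha₂, this]
    exact congr(($this).left)
  · refine ⟨U.pullback₁ (zeroSec e he Z ≫ g).left, fun (i : U.I₀) => ?_⟩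
    let Z' : Over S := Over.mk (pullback.fst (zeroSec e he Z ≫ g).left (U.f i) ≫ Z.hom)
    let j : Z' ⟶ Z := Over.homMk (pullback.fst (zeroSec e he Z ≫ g).left (U.f i))
    have := oi2 i
    obtain ⟨g', hg'⟩ : ∃ g', g' ≫ inc i = (prodFunctor p).map j ≫ g := by
      apply exists_lift e he (inc i)
      rw [← zeroSec_naturality_assoc]
      have : (j ≫ zeroSec e he Z ≫ g).left =
          pullback.snd (zeroSec e he Z ≫ g).left (U.f i) ≫ U.f i := pullback.condition
      rw [this]
      rintro _ ⟨y, rfl⟩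
      exact ⟨pullback.snd (zeroSec e he Z ≫ g).left (U.f i) y, by simp [inc]⟩
    obtain ⟨h, hh, -⟩ := hL i _ g'
    have hh : (prodFunctor p).map h ≫ L i = g' := hh
    refine ⟨h ≫ c' i, ?_⟩
    have := hcinc i h
    rw [reassoc_of% hh, hg'] at this
    exact this

/-- Representability is local on `X`. -/
theorem exists_isUniversal_of_cover (e : S ⟶ D) (he : e ≫ p = 𝟙 S) [Surjective e] {X : Over S} (U : Scheme.OpenCover.{u} X.left)
    [Category.{u} U.I₀] [U.LocallyDirected] [Quiver.IsThin U.I₀]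
    (H : ∀ i, ∃ (Y : Over S) (L : (prodFunctor p).obj Y ⟶ Over.mk (U.f i ≫ X.hom)),
      IsUniversal L) :
    ∃ (Y : Over S) (L : (prodFunctor p).obj Y ⟶ X), IsUniversal L := by
  choose Y L hL using H
  let tr {i j : U.I₀} (f : i ⟶ j) : Over.mk (U.f i ≫ X.hom) ⟶ Over.mk (U.f j ≫ X.hom) :=
    Over.homMk (U.trans f) (by
      change U.trans f ≫ U.f j ≫ X.hom = U.f i ≫ X.hom
      rw [← Category.assoc, Scheme.Cover.trans_map])
  let inc (i : U.I₀) : Over.mk (U.f i ≫ X.hom) ⟶ X := Over.homMk (U.f i)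
  have tr_inc {i j : U.I₀} (f : i ⟶ j) : tr f ≫ inc j = inc i := by
    ext1; simp [tr, inc]
  have key {i j : U.I₀} (f : i ⟶ j) := (hL j _ (L i ≫ tr f)).exists
  choose Yt hYt using @key
  have oi1 {i j : U.I₀} (f : i ⟶ j) : IsOpenImmersion (tr f).left :=
    inferInstanceAs (IsOpenImmersion (U.trans f))
  have oi2 (i : U.I₀) : IsOpenImmersion (inc i).left :=
    inferInstanceAs (IsOpenImmersion (U.f i))
  let F : U.I₀ ⥤ Over S :=
    { obj := Y
      map := Yt
      map_id := fun i => by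
        refine (hL i _ (L i)).unique ?_ ?_
        · rw [hYt]
          have : tr (𝟙 i) = 𝟙 _ := by ext1; simp [tr]
          rw [this, Category.comp_id]
        · simp
      map_comp := fun {i j k} f g => by
        refine (hL k _ (L i ≫ tr (f ≫ g))).unique (hYt _) ?_
        rw [Functor.map_comp, Category.assoc, hYt, ← Category.assoc, hYt, Category.assoc]
        congr 1
        ext1; simp [tr] }
  let d : Scheme.Cover.RelativeGluingData U :=
    { functor := F ⋙ Over.forget S
      natTrans :=
        { app := fun i => (zeroSec e he (Y i) ≫ L i).left
          naturality := fun i j f => by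
            have : Yt f ≫ zeroSec e he (Y j) ≫ L j = (zeroSec e he (Y i) ≫ L i) ≫ tr f := by
              rw [zeroSec_naturality_assoc, hYt, Category.assoc]
            exact congr(($this).left) }
      equifibered := fun {i j} f =>
        isPullback_of_isUniversal e he (tr f) (hL j) (hL i) (Yt f) (hYt f) }
  obtain ⟨G, b, c, hc, hp⟩ := exists_glued U d
  exact exists_isUniversal_of_glued e he U Y L hL Yt tr (fun _ => rfl) hYt G b c hc hp

end General

open TensorProduct

section Algebra

variable {R : Type u} [CommRing R] {E : Type u} [CommRing E] [Algebra R E] {n : ℕ}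
  (β : Module.Basis (Fin n) R E)

/-- The `j`-th coordinate of an element of `B ⊗ E`. -/
noncomputable def coord (B : Type u) [CommRing B] [Algebra R B] (x : B ⊗[R] E) (j : Fin n) : B :=
  (β.baseChange B).repr x j

lemma sum_coord {B : Type u} [CommRing B] [Algebra R B] (x : B ⊗[R] E) :
    ∑ j, coord β B x j ⊗ₜ[R] β j = x := by
  conv_rhs => rw [← (β.baseChange B).sum_repr x]
  simp [coord, TensorProduct.smul_tmul']

lemma coord_map {B C : Type u} [CommRing B] [Algebra R B] [CommRing C] [Algebra R C] (f : B →ₐ[R] C)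
    (x : B ⊗[R] E) (j : Fin n) :
    coord β C (Algebra.TensorProduct.map f (AlgHom.id R E) x) j = f (coord β B x j) := by
  unfold coord
  induction x with
  | zero => simp
  | tmul b e => simp [Algebra.smul_def]
  | add x y hx hy => simp [hx, hy]

lemma coord_ext {B : Type u} [CommRing B] [Algebra R B] {x y : B ⊗[R] E}
    (h : ∀ j, coord β B x j = coord β B y j) : x = y := by
  rw [← sum_coord β x, ← sum_coord β y]
  simp [h]

lemma coord_sum {B : Type u} [CommRing B] [Algebra R B] (b : Fin n → B) (j : Fin n) :
    coord β B (∑ i, b i ⊗ₜ[R] β i) j = b j := by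
  classical
  simp [coord, Finsupp.single_apply]

variable {A : Type u} [CommRing A] [Algebra R A] {σ : Type u} (f : MvPolynomial σ R →ₐ[R] A)

/-- The generic family `x_s ↦ ∑_j x_s^{(j)} β_j`. -/
noncomputable def generic : MvPolynomial σ R →ₐ[R] MvPolynomial (σ × Fin n) R ⊗[R] E :=
  MvPolynomial.aeval fun s => ∑ j, MvPolynomial.X (s, j) ⊗ₜ[R] β j

/-- The ideal generated by the coordinates of the image of `ker f` under the generic family. -/
noncomputable def jetIdeal : Ideal (MvPolynomial (σ × Fin n) R) :=
  Ideal.span {a | ∃ F, f F = 0 ∧ ∃ j, coord β _ (generic β F) j = a}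

/-- The generic family reduced modulo the relations. -/
noncomputable def genericQuot :
    MvPolynomial σ R →ₐ[R] (MvPolynomial (σ × Fin n) R ⧸ jetIdeal β f) ⊗[R] E :=
  (Algebra.TensorProduct.map (Ideal.Quotient.mkₐ R (jetIdeal β f)) (AlgHom.id R E)).comp (generic β)

lemma genericQuot_eq_zero (F : MvPolynomial σ R) (hF : f F = 0) : genericQuot β f F = 0 := by
  apply coord_ext β
  intro j
  rw [genericQuot, AlgHom.comp_apply, coord_map]
  have : coord β (MvPolynomial (σ × Fin n) R ⧸ jetIdeal β f) 0 j = 0 := by simp [coord]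
  rw [this]
  exact Ideal.Quotient.eq_zero_iff_mem.mpr (Ideal.subset_span ⟨F, hF, j, rfl⟩)

/-- The algebra `MvPolynomial (σ × Fin n) R ⧸ jetIdeal β f` corepresents `B ↦ Hom_R(A, B ⊗ E)`. -/
theorem exists_universal_algebra (hf : Function.Surjective f) :
    ∃ l : A →ₐ[R] (MvPolynomial (σ × Fin n) R ⧸ jetIdeal β f) ⊗[R] E,
      (∀ F, l (f F) = genericQuot β f F) ∧
      ∀ (B : Type u) [CommRing B] [Algebra R B] (φ : A →ₐ[R] B ⊗[R] E),
        ∃! ψ : (MvPolynomial (σ × Fin n) R ⧸ jetIdeal β f) →ₐ[R] B,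
          (Algebra.TensorProduct.map ψ (AlgHom.id R E)).comp l = φ := by
  let l : A →ₐ[R] (MvPolynomial (σ × Fin n) R ⧸ jetIdeal β f) ⊗[R] E :=
    (Ideal.Quotient.liftₐ (RingHom.ker f) (genericQuot β f) (genericQuot_eq_zero β f)).comp
      (Ideal.quotientKerAlgEquivOfSurjective hf).symm.toAlgHom
  have hl (F) : l (f F) = genericQuot β f F := by
    have : (Ideal.quotientKerAlgEquivOfSurjective hf).symm (f F) = Ideal.Quotient.mk _ F := by
      rw [AlgEquiv.symm_apply_eq]
      rfl
    change (Ideal.Quotient.liftₐ (RingHom.ker f) (genericQuot β f) (genericQuot_eq_zero β f))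
      ((Ideal.quotientKerAlgEquivOfSurjective hf).symm (f F)) = _
    rw [this]
    rfl
  refine ⟨l, hl, fun B _ _ φ => ?_⟩
  have hX (ψ : (MvPolynomial (σ × Fin n) R ⧸ jetIdeal β f) →ₐ[R] B) (s : σ) (j : Fin n) :
      ψ (Ideal.Quotient.mk _ (MvPolynomial.X (s, j))) = coord β B
        ((Algebra.TensorProduct.map ψ (AlgHom.id R E)).comp l (f (MvPolynomial.X s))) j := by
    rw [AlgHom.comp_apply, coord_map, hl, genericQuot, AlgHom.comp_apply, coord_map, generic,
      MvPolynomial.aeval_X, coord_sum]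
    rfl
  let ψ₀ : MvPolynomial (σ × Fin n) R →ₐ[R] B :=
    MvPolynomial.aeval fun s => coord β B (φ (f (MvPolynomial.X s.1))) s.2
  have h₀ : (Algebra.TensorProduct.map ψ₀ (AlgHom.id R E)).comp (generic β) = φ.comp f := by
    apply MvPolynomial.algHom_ext
    intro s
    apply coord_ext β
    intro j
    rw [AlgHom.comp_apply, coord_map, generic, MvPolynomial.aeval_X, coord_sum]
    simp [ψ₀]
  have hI : ∀ a ∈ jetIdeal β f, ψ₀ a = 0 := by
    intro a ha
    have : jetIdeal β f ≤ RingHom.ker ψ₀ := by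
      rw [jetIdeal, Ideal.span_le]
      rintro _ ⟨F, hF, j, rfl⟩
      have := DFunLike.congr_fun h₀ F
      rw [AlgHom.comp_apply, AlgHom.comp_apply, hF, map_zero] at this
      change ψ₀ _ = 0
      rw [← coord_map, this]
      simp [coord]
    exact this ha
  refine ⟨Ideal.Quotient.liftₐ _ ψ₀ hI, ?_, ?_⟩
  · apply AlgHom.ext
    intro a
    obtain ⟨F, rfl⟩ := hf a
    rw [AlgHom.comp_apply, hl, ← AlgHom.comp_apply φ, ← h₀, genericQuot, ← AlgHom.comp_apply,
      ← AlgHom.comp_assoc, ← Algebra.TensorProduct.map_comp]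
    congr 2
  · intro ψ hψ
    apply Ideal.Quotient.algHom_ext
    apply MvPolynomial.algHom_ext
    rintro ⟨s, j⟩
    refine (hX ψ s j).trans ?_
    rw [hψ]
    change _ = ψ₀ (MvPolynomial.X (s, j))
    simp [ψ₀]

end Algebra

section Affine

variable {R : Type u} [CommRing R] {E : Type u} [CommRing E] [Algebra R E]

/-- An `R`-algebra as a scheme over `Spec R`. -/
noncomputable abbrev specOver (R B : Type u) [CommRing R] [CommRing B] [Algebra R B] :
    Over (Spec (CommRingCat.of R)) :=
  Over.mk (Spec.map (CommRingCat.ofHom (algebraMap R B)))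

/-- The structure morphism `Spec E ⟶ Spec R`. -/
noncomputable abbrev structMap (R E : Type u) [CommRing R] [CommRing E] [Algebra R E] :
    Spec (CommRingCat.of E) ⟶ Spec (CommRingCat.of R) :=
  Spec.map (CommRingCat.ofHom (algebraMap R E))

/-- `Spec B ×_R Spec E` is `Spec (B ⊗ E)`. -/
noncomputable def prodSpecIso (R E B : Type u) [CommRing R] [CommRing E] [Algebra R E] [CommRing B]
    [Algebra R B] :
    (prodFunctor (structMap R E)).obj (specOver R B) ≅ specOver R (B ⊗[R] E) :=
  Over.isoMk (pullbackSpecIso R B E) (by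
    change (pullbackSpecIso R B E).hom ≫ Spec.map (CommRingCat.ofHom (algebraMap R _)) = _
    rw [pullbackSpecIso_hom_base]
    exact fst_comp (structMap R E) (specOver R B))

/-- The morphism of schemes over `Spec R` attached to a homomorphism of `R`-algebras. -/
noncomputable def specMap {B C : Type u} [CommRing B] [Algebra R B] [CommRing C] [Algebra R C]
    (f : B →ₐ[R] C) : specOver R C ⟶ specOver R B :=
  Over.homMk (Spec.map (CommRingCat.ofHom f.toRingHom)) (by
    change Spec.map _ ≫ Spec.map _ = Spec.map _
    rw [← Spec.map_comp, ← CommRingCat.ofHom_comp]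
    congr 2
    exact f.comp_algebraMap)

lemma specMap_comp {B C D : Type u} [CommRing B] [Algebra R B] [CommRing C] [Algebra R C]
    [CommRing D] [Algebra R D] (f : B →ₐ[R] C) (g : C →ₐ[R] D) :
    specMap (g.comp f) = specMap g ≫ specMap f := by
  ext1
  change Spec.map _ = Spec.map _ ≫ Spec.map _
  rw [← Spec.map_comp, ← CommRingCat.ofHom_comp]
  rfl

lemma specMap_bijective (B C : Type u) [CommRing B] [Algebra R B] [CommRing C] [Algebra R C] :
    Function.Bijective (specMap : (B →ₐ[R] C) → (specOver R C ⟶ specOver R B)) := by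
  constructor
  · intro f g h
    have : Spec.map (CommRingCat.ofHom f.toRingHom) = Spec.map (CommRingCat.ofHom g.toRingHom) :=
      congr(($h).left)
    have := Spec.map_injective this
    ext x
    exact congr(($this).hom x)
  · intro h
    obtain ⟨f, hf⟩ := Spec.map_surjective h.left
    have hw : h.left ≫ Spec.map (CommRingCat.ofHom (algebraMap R B)) =
      Spec.map (CommRingCat.ofHom (algebraMap R C)) := Over.w h
    rw [← hf, ← Spec.map_comp] at hw
    have := Spec.map_injective hw
    refine ⟨{ f.hom with commutes' := fun r => congr(($this).hom r) }, ?_⟩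
    ext1
    exact hf

lemma prodSpecIso_naturality {B C : Type u} [CommRing B] [Algebra R B] [CommRing C] [Algebra R C]
    (f : B →ₐ[R] C) :
    (prodFunctor (structMap R E)).map (specMap f) ≫ (prodSpecIso R E B).hom =
      (prodSpecIso R E C).hom ≫ specMap (Algebra.TensorProduct.map f (AlgHom.id R E)) := by
  have h1 (B : Type u) [CommRing B] [Algebra R B] : (prodSpecIso R E B).inv.left ≫
      fst (structMap R E) (specOver R B) =
      Spec.map (CommRingCat.ofHom Algebra.TensorProduct.includeLeftRingHom) :=
    pullbackSpecIso_inv_fst R B E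
  have h2 (B : Type u) [CommRing B] [Algebra R B] : (prodSpecIso R E B).inv.left ≫
      snd (structMap R E) (specOver R B) = Spec.map (CommRingCat.ofHom
        (Algebra.TensorProduct.includeRight (R := R) (A := B) (B := E)).toRingHom) :=
    pullbackSpecIso_inv_snd R B E
  rw [← Iso.inv_comp_eq, ← Category.assoc, ← Iso.eq_comp_inv]
  ext1
  apply (isPullback _ _).hom_ext
  · rw [Over.comp_left, Over.comp_left, Category.assoc, Category.assoc, map_fst, h1,
      reassoc_of% h1 C]
    change Spec.map _ ≫ Spec.map _ = Spec.map _ ≫ Spec.map _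
    rw [← Spec.map_comp, ← Spec.map_comp, ← CommRingCat.ofHom_comp, ← CommRingCat.ofHom_comp]
    congr 2
  · rw [Over.comp_left, Over.comp_left, Category.assoc, Category.assoc, map_snd, h2, h2]
    change Spec.map _ = Spec.map _ ≫ Spec.map _
    rw [← Spec.map_comp, ← CommRingCat.ofHom_comp]
    congr 2
    ext x
    simp

variable {n : ℕ}

lemma exists_isUniversal_affine (β : Module.Basis (Fin n) R E) (A : Type u) [CommRing A] [Algebra R A] :
    ∃ (Y : Over (Spec (CommRingCat.of R)))
      (L : (prodFunctor (structMap R E)).obj Y ⟶ specOver R A), IsUniversal L := by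
  obtain ⟨W, _, _, l, hl⟩ : ∃ (W : Type u) (_ : CommRing W) (_ : Algebra R W)
      (l : A →ₐ[R] W ⊗[R] E), ∀ (B : Type u) [CommRing B] [Algebra R B] (φ : A →ₐ[R] B ⊗[R] E),
        ∃! ψ : W →ₐ[R] B, (Algebra.TensorProduct.map ψ (AlgHom.id R E)).comp l = φ := by
    let f : MvPolynomial A R →ₐ[R] A := MvPolynomial.aeval id
    have hf : Function.Surjective f := fun a => ⟨MvPolynomial.X a, by simp [f]⟩
    obtain ⟨l, -, hl⟩ := exists_universal_algebra β f hf
    exact ⟨_, _, _, l, hl⟩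
  let L : (prodFunctor (structMap R E)).obj (specOver R W) ⟶ specOver R A :=
    (prodSpecIso R E W).hom ≫ specMap l
  have key (B : CommRingCat.{u}) (s : Spec B ⟶ Spec (CommRingCat.of R))
      (g : (prodFunctor (structMap R E)).obj (Over.mk s) ⟶ specOver R A) :
      ∃! h : Over.mk s ⟶ specOver R W, (prodFunctor (structMap R E)).map h ≫ L = g := by
    obtain ⟨b, rfl⟩ := Spec.map_surjective s
    let _ : Algebra R B := b.hom.toAlgebra
    change (prodFunctor (structMap R E)).obj (specOver R B) ⟶ specOver R A at g
    change ∃! h : specOver R B ⟶ specOver R W, (prodFunctor (structMap R E)).map h ≫ L = g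
    obtain ⟨φ, hφ⟩ := (specMap_bijective A (B ⊗[R] E)).2 ((prodSpecIso R E B).inv ≫ g)
    have e (ψ : W →ₐ[R] B) : (prodFunctor (structMap R E)).map (specMap ψ) ≫ L = g ↔
        (Algebra.TensorProduct.map ψ (AlgHom.id R E)).comp l = φ := by
      rw [← (specMap_bijective A (B ⊗[R] E)).1.eq_iff, specMap_comp, hφ, ← cancel_epi
        (prodSpecIso R E B).hom, Iso.hom_inv_id_assoc]
      simp only [L]
      rw [← Category.assoc, prodSpecIso_naturality, Category.assoc]
    obtain ⟨ψ, h1, h2⟩ := hl B φ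
    refine ⟨specMap ψ, (e ψ).2 h1, fun y hy => ?_⟩
    obtain ⟨ψ', rfl⟩ := (specMap_bijective W B).2 y
    rw [h2 ψ' ((e ψ').1 hy)]
  refine ⟨_, L, isUniversal_of_cover (atMostOne_of_cover fun Z h₁ h₂ h => ?_) fun Z g => ?_⟩
  · have uniq (B : CommRingCat.{u}) (s : Spec B ⟶ Spec (CommRingCat.of R)) (j : Over.mk s ⟶ Z) :
        j ≫ h₁ = j ≫ h₂ := by
      refine (key B s ((prodFunctor (structMap R E)).map (j ≫ h₂) ≫ L)).unique ?_ rfl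
      rw [Functor.map_comp, Functor.map_comp, Category.assoc, Category.assoc, h]
    refine ⟨Z.left.affineCover, fun i => ?_⟩
    exact congr(($(uniq _ (Z.left.affineCover.f i ≫ Z.hom)
      (Over.homMk (Z.left.affineCover.f i)))).left)
  · exact ⟨Z.left.affineCover, fun i => (key _ (Z.left.affineCover.f i ≫ Z.hom) _).exists⟩

theorem exists_isUniversal (β : Module.Basis (Fin n) R E) (e : E →ₐ[R] R) (he : ∀ x, e x = 0 → IsNilpotent x)
    (X : Over (Spec (CommRingCat.of R))) :
    ∃ (Y : Over (Spec (CommRingCat.of R)))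
      (L : (prodFunctor (structMap R E)).obj Y ⟶ X), IsUniversal L := by
  let ε : Spec (CommRingCat.of R) ⟶ Spec (CommRingCat.of E) :=
    Spec.map (CommRingCat.ofHom e.toRingHom)
  have hε : ε ≫ structMap R E = 𝟙 _ := by
    rw [← Spec.map_comp, ← CommRingCat.ofHom_comp]
    have : e.toRingHom.comp (algebraMap R E) = RingHom.id R := e.comp_algebraMap
    rw [this]
    exact Spec.map_id _
  have : Surjective ε := by
    refine ⟨fun x => ?_⟩
    have h1 : Function.Surjective e := fun r => ⟨algebraMap R E r, e.commutes r⟩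
    have h2 : RingHom.ker e.toRingHom ≤ nilradical E := fun x hx => he x hx
    have := range_comap_of_surjective _ e.toRingHom h1
    have hx : x ∈ Set.range (PrimeSpectrum.comap e.toRingHom) := by
      rw [this]
      intro y hy
      have hp : (show PrimeSpectrum E from x).asIdeal.IsPrime := PrimeSpectrum.isPrime _
      exact nilradical_le_prime (show PrimeSpectrum E from x).asIdeal (h2 hy)
    exact hx
  refine exists_isUniversal_of_cover ε hε X.left.directedAffineCover
    fun (U : X.left.affineOpens) => ?_
  let s : Spec Γ(U.1, ⊤) ⟶ Spec (CommRingCat.of R) :=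
    U.1.toScheme.isoSpec.inv ≫ U.1.ι ≫ X.hom
  have hU : IsAffine U.1 := U.2
  obtain ⟨b, hb⟩ := Spec.map_surjective s
  let _ : Algebra R Γ(U.1, ⊤) := b.hom.toAlgebra
  obtain ⟨Y, L, hL⟩ := exists_isUniversal_affine β Γ(U.1, ⊤)
  let i : specOver R Γ(U.1, ⊤) ≅ Over.mk (U.1.ι ≫ X.hom) :=
    Over.isoMk U.1.toScheme.isoSpec.symm hb.symm
  exact ⟨Y, L ≫ i.hom, hL.comp_iso i⟩

theorem isRepresentable (β : Module.Basis (Fin n) R E) (e : E →ₐ[R] R) (he : ∀ x, e x = 0 → IsNilpotent x)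
    (X : Over (Spec (CommRingCat.of R))) :
    ((prodFunctor (structMap R E)).op ⋙ yoneda.obj X).IsRepresentable :=
  have ⟨_, _, hL⟩ := exists_isUniversal β e he X
  hL.isRepresentable

end Affine
end JetScheme

/-! ### Jet schemes -/

section Jets

variable {k : Type u} [Field k]

/-- The truncated polynomial ring `k[t]/(t^{m+1})`. -/
abbrev TruncPoly (k : Type u) [Field k] (m : ℕ) : Type u :=
  AdjoinRoot ((Polynomial.X : Polynomial k) ^ (m + 1))

/-- For a scheme `X` over `k`, the functor `Z ↦ Hom_k(Z ×_k Spec k[t]/(t^{m+1}), X)` of `m`-jets of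
`X`, on the category of all `k`-schemes `Z`. -/
noncomputable def jetFunctor (m : ℕ) (X : Over (Spec (CommRingCat.of k))) :
    (Over (Spec (CommRingCat.of k)))ᵒᵖ ⥤ Type u :=
  (JetScheme.prodFunctor (JetScheme.structMap k (TruncPoly k m))).op ⋙ yoneda.obj X

instance (m : ℕ) (X : Over (Spec (CommRingCat.of k))) : (jetFunctor m X).IsRepresentable := by
  refine JetScheme.isRepresentable
    (AdjoinRoot.powerBasis' (Polynomial.monic_X_pow (R := k) (m + 1))).basis
    (AdjoinRoot.liftAlgHom _ (AlgHom.id k k) 0 (by simp)) (fun x hx => ?_) X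
  obtain ⟨f, rfl⟩ := AdjoinRoot.mk_surjective x
  refine ⟨m + 1, ?_⟩
  have h : f.coeff 0 = 0 := by simpa using hx
  rw [← Polynomial.X_dvd_iff] at h
  rw [← map_pow, AdjoinRoot.mk_eq_zero]
  exact pow_dvd_pow_of_dvd h _

/-- The `m`-jet scheme `X_m` of a scheme `X` over `k`: the `k`-scheme that represents the functor of
`m`-jets, `Hom_k(Z, X_m) ≃ Hom_k(Z ×_k Spec k[t]/(t^{m+1}), X)`. -/
noncomputable def jetScheme (m : ℕ) (X : Over (Spec (CommRingCat.of k))) :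
    Over (Spec (CommRingCat.of k)) :=
  (jetFunctor m X).reprX

end Jets

/-! ### Local complete intersections -/

section LCI

variable {k : Type u} [Field k]

/-- Affine `N`-space `Spec k[x_1, …, x_N]` over `k`. -/
noncomputable abbrev affineSpaceOver (k : Type u) [Field k] (N : ℕ) :
    Over (Spec (CommRingCat.of k)) :=
  JetScheme.specOver k (MvPolynomial (Fin N) k)

/-- A `k`-scheme `X` is a complete intersection at the point `x` if some open neighbourhood `U` of
`x` is a closed subscheme of an affine space `𝔸^N` over `k` such that the ideal of `U` in the local
ring `𝒪_{𝔸^N, x}`, i.e. the kernel of `𝒪_{𝔸^N, x} → 𝒪_{U, x}`, is generated by `c` elements, where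
`c = dim 𝒪_{𝔸^N, x} - dim 𝒪_{U, x}` is the codimension of `U` in `𝔸^N` at `x`. -/
def IsCompleteIntersectionAt (X : Over (Spec (CommRingCat.of k))) (x : X.left) : Prop :=
  ∃ (U : X.left.Opens) (hx : x ∈ U) (N : ℕ)
    (i : Over.mk (U.ι ≫ X.hom) ⟶ affineSpaceOver k N),
    IsClosedImmersion i.left ∧
    ∃ (c : ℕ) (f : Fin c → (affineSpaceOver k N).left.presheaf.stalk (i.left ⟨x, hx⟩)),
      Ideal.span (Set.range f) = RingHom.ker (i.left.stalkMap ⟨x, hx⟩).hom ∧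
      ringKrullDim (U.toScheme.presheaf.stalk ⟨x, hx⟩) + c =
        ringKrullDim ((affineSpaceOver k N).left.presheaf.stalk (i.left ⟨x, hx⟩))

/-- A `k`-scheme is locally a complete intersection if it is a complete intersection at each of its
points. -/
def IsLocallyCompleteIntersection (X : Over (Spec (CommRingCat.of k))) : Prop :=
  ∀ x : X.left, IsCompleteIntersectionAt X x

end LCI

/-!
The scheme `X` is a retract of its jet scheme `X_m`: the constant jets form a section of the
projection `X_m ⟶ X` (`exists_retraction_jetScheme`). Being a complete intersection at a point is
inherited by retracts of `k`-schemes (`isCompleteIntersectionAt_of_retract`), which is a statement on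
local rings (`exists_generators_of_retract`).

For the latter let `A → B → A` be the retraction of local rings, `R₁ = k[x₁, …, xₙ]_p → A` and
`R₂ = k[z₁, …, z_N]_q → B` presentations, and suppose that `ker (R₂ → B)` is generated by
`c = dim R₂ - dim B` elements. The residue field `κ` of `A` is also that of `B`. Let `T` be the local
ring of `𝔸ⁿ⁺ᴺ` at the kernel of `k[x, z] → κ`. It retracts onto `R₁` and onto `R₂`, because each `zⱼ`
can be sent to a lift to `R₁` of its image in `A`, and each `xᵢ` to a lift to `R₂` of its image in
`B`. Let `K` be the kernel of `T → R₂ → B`. It is generated by `n + c` elements.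

Let `f₁, …, f_r` be minimal generators of `I = ker (R₁ → A)`. Their images in `T` lie in `K`, and they
are linearly independent in `K / 𝔪 K`, since the retraction `T → R₁` carries `K` to `I` and `𝔪 K` to
`𝔪 I`. So they are part of a generating family of `K` with at most `n + c` members
(`exists_generators_extending`), and hence
`dim T / (f) + r ≤ dim B + n + c = dim R₂ + n ≤ dim T ≤ dim R₁ + N`.
On the other hand `T / (f)` maps onto the local ring of `𝔸ᴺ` over `A` at a rational point, so
`dim A + N ≤ dim T / (f)` (`exists_surjective_and_ringKrullDim_ge`). Together these give
`dim A + r ≤ dim R₁`, which is all that is needed, as the opposite inequality always holds.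
-/

namespace LCIRetract

open IsLocalRing MvPolynomial

/-! ### Minimal generators over a local ring -/

/-- Steinitz exchange for ideals of a local ring: elements of `K` that are independent modulo `𝔪 K`
can replace equally many members of a given finite generating family of `K`. -/
theorem exists_generators_extending {T : Type*} [CommRing T] [IsLocalRing T] {K : Ideal T} {r s : ℕ}
    {f : Fin r → T} {g : Fin s → T} (hg : Ideal.span (Set.range g) = K) (hf : ∀ i, f i ∈ K)
    (hind : ∀ a : Fin r → T, ∑ i, a i * f i ∈ maximalIdeal T * K → ∀ i, a i ∈ maximalIdeal T) :
    ∃ G : Finset T, G.card + r ≤ s ∧ Ideal.span (Set.range f ∪ G) = K := by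
  classical
  suffices h : ∀ J : Finset (Fin r),
      ∃ G : Finset T, G.card + J.card ≤ s ∧ Ideal.span (f '' J ∪ G) = K by
    simpa using h Finset.univ
  intro J
  induction J using Finset.induction_on with
  | empty =>
    refine ⟨Finset.univ.image g, ?_, by simpa using hg⟩
    simpa using Finset.card_image_le (s := Finset.univ) (f := g)
  | insert j J hj ih =>
    obtain ⟨G, hc, hG⟩ := ih
    obtain ⟨y, hy, z, hz, hyz⟩ := Submodule.mem_sup.mp
      (show f j ∈ Ideal.span (f '' J) ⊔ Ideal.span (G : Set T) by
        rw [← Ideal.span_union, hG]; exact hf j)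
    obtain ⟨b, -, rfl⟩ := Submodule.mem_span_finset.mp hz
    obtain ⟨a, rfl⟩ : ∃ a : Fin r → T, ∑ i ∈ J, a i • f i = y := by
      obtain ⟨a, rfl⟩ := (Submodule.mem_span_image_finset_iff_exists_fun T).mp hy
      refine ⟨fun i => if h : i ∈ J then a ⟨i, h⟩ else 0, ?_⟩
      rw [← Finset.sum_coe_sort]
      simp
    have hGK : ∀ x ∈ G, x ∈ K := fun x hx => hG ▸ Ideal.subset_span (Or.inr hx)
    -- Some coefficient is a unit, as otherwise `f j - ∑ a i * f i` would lie in `𝔪 K`.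
    obtain ⟨x, hx, hbx⟩ : ∃ x ∈ G, IsUnit (b x) := by
      by_contra! hcon
      have h1 : ∑ x ∈ G, b x • x ∈ maximalIdeal T * K :=
        Ideal.sum_mem _ fun x hx => Ideal.mul_mem_mul (hcon x hx) (hGK x hx)
      have h2 := hind (fun i => if i = j then 1 else if i ∈ J then - a i else 0) (by
        have : ∑ i, (if i = j then 1 else if i ∈ J then - a i else 0) * f i =
            f j - ∑ i ∈ J, a i * f i := by
          rw [← Finset.add_sum_erase _ _ (Finset.mem_univ j), sub_eq_add_neg,
            ← Finset.sum_neg_distrib]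
          congr 1
          · simp
          · rw [← Finset.sum_subset (s₁ := J) (fun i hi => by
              simp only [Finset.mem_erase, Finset.mem_univ, and_true]
              rintro rfl; exact hj hi)]
            · refine Finset.sum_congr rfl fun i hi => ?_
              rw [if_neg (by rintro rfl; exact hj hi), if_pos hi, neg_mul]
            · intro i hi hi'
              rw [if_neg (Finset.ne_of_mem_erase hi), if_neg hi', zero_mul]
        rw [this, ← hyz]
        simpa using h1) j
      simp at h2
    refine ⟨G.erase x, ?_, ?_⟩
    · rw [Finset.card_insert_of_notMem hj]
      have := Finset.card_erase_add_one hx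
      omega
    · apply le_antisymm
      · rw [Ideal.span_le, Finset.coe_insert, Set.image_insert_eq]
        rintro w ((rfl | hw) | hw)
        · exact hf j
        · exact hG ▸ Ideal.subset_span (Or.inl hw)
        · exact hGK w (Finset.mem_of_mem_erase hw)
      · rw [← hG, Ideal.span_le]
        have hJ : ∀ i ∈ J, f i ∈ Ideal.span (f '' ↑(insert j J) ∪ ↑(G.erase x)) := fun i hi =>
          Ideal.subset_span (Or.inl ⟨i, by simp [hi], rfl⟩)
        have hE : ∀ w ∈ G.erase x, w ∈ Ideal.span (f '' ↑(insert j J) ∪ ↑(G.erase x)) :=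
          fun w hw => Ideal.subset_span (Or.inr hw)
        rintro w (⟨i, hi, rfl⟩ | hw)
        · exact hJ i hi
        · by_cases hwx : w = x
          · subst hwx
            refine (Ideal.unit_mul_mem_iff_mem _ hbx).mp ?_
            have : b w * w = f j - ∑ i ∈ J, a i • f i - ∑ y ∈ G.erase w, b y • y := by
              rw [← hyz, ← Finset.add_sum_erase _ _ hx]
              simp
            rw [this]
            refine Ideal.sub_mem _ (Ideal.sub_mem _ (Ideal.subset_span (Or.inl ⟨j, by simp, rfl⟩))
              (Ideal.sum_mem _ fun i hi => Ideal.mul_mem_left _ _ (hJ i hi)))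
              (Ideal.sum_mem _ fun y hy => Ideal.mul_mem_left _ _ (hE y hy))
          · exact hE w (Finset.mem_erase.mpr ⟨hwx, hw⟩)

/-- An ideal `I` of a Noetherian local ring is generated by a family whose classes in `I / 𝔪 I` are
linearly independent over the residue field. -/
theorem exists_minimal_generators {R : Type*} [CommRing R] [IsLocalRing R] [IsNoetherianRing R]
    (I : Ideal R) : ∃ (r : ℕ) (f : Fin r → R), Ideal.span (Set.range f) = I ∧
      ∀ a : Fin r → R, ∑ i, a i * f i ∈ maximalIdeal R * I → ∀ i, a i ∈ maximalIdeal R := by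
  classical
  have hex : ∃ (r : ℕ) (f : Fin r → R), Ideal.span (Set.range f) = I := by
    obtain ⟨S, hS⟩ := IsNoetherian.noetherian I
    refine ⟨S.card, fun i => (S.equivFin.symm i : R), ?_⟩
    rw [← hS]
    congr 1
    ext x
    refine ⟨?_, fun hx => ⟨S.equivFin ⟨x, hx⟩, by simp⟩⟩
    rintro ⟨i, rfl⟩
    exact (S.equivFin.symm i).2
  obtain ⟨f, hf⟩ := Nat.find_spec hex
  refine ⟨_, f, hf, fun a ha j => ?_⟩
  by_contra hj
  have hu : IsUnit (a j) := by simpa using hj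
  have hm := Nat.find_min hex (m := Nat.find hex - 1) (by have := j.2; omega)
  obtain ⟨n, hn⟩ : ∃ n, Nat.find hex = n + 1 := ⟨Nat.find hex - 1, by have := j.2; omega⟩
  generalize Nat.find hex = N at *
  subst hn
  refine hm ⟨fun i => f (j.succAbove i), ?_⟩
  have hle : Ideal.span (Set.range fun i => f (j.succAbove i)) ≤ I := by
    rw [← hf]
    exact Ideal.span_mono (by rintro _ ⟨i, rfl⟩; exact ⟨_, rfl⟩)
  refine le_antisymm hle ?_
  refine Submodule.le_of_le_smul_of_le_jacobson_bot (IsNoetherian.noetherian I)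
    (maximalIdeal_le_jacobson _) ?_
  rw [smul_eq_mul]
  have key : ∀ i, f (j.succAbove i) ∈
      Ideal.span (Set.range fun i => f (j.succAbove i)) ⊔ maximalIdeal R * I :=
    fun i => Ideal.mem_sup_left (Ideal.subset_span ⟨i, rfl⟩)
  conv_lhs => rw [← hf]
  rw [Ideal.span_le]
  rintro _ ⟨i, rfl⟩
  rcases Fin.eq_self_or_eq_succAbove j i with rfl | ⟨i, rfl⟩
  · refine (Ideal.unit_mul_mem_iff_mem _ hu).mp ?_
    rw [Fin.sum_univ_succAbove _ i] at ha
    have : a i * f i = (a i * f i + ∑ l, a (i.succAbove l) * f (i.succAbove l)) -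
        ∑ l, a (i.succAbove l) * f (i.succAbove l) := by ring
    rw [this]
    exact Ideal.sub_mem _ (Ideal.mem_sup_right ha)
      (Ideal.sum_mem _ fun l _ => Ideal.mul_mem_left _ _ (key l))
  · exact key i

/-! ### Rational points of polynomial rings -/

/-- The kernel of `φ : C[z₁, …, zₙ] → κ` is a point of affine `n`-space over `C` that is rational over
the point `ker (φ ∘ C)` of `Spec C`, so its height exceeds that of the latter by `n`. -/
theorem height_ker_mvPolynomial {C κ : Type*} [CommRing C] [IsNoetherianRing C] [Field κ] (n : ℕ)
    (φ : MvPolynomial (Fin n) C →+* κ)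
    (hφ : Function.Surjective (φ.comp MvPolynomial.C)) :
    (RingHom.ker φ).height = (RingHom.ker (φ.comp MvPolynomial.C)).height + n := by
  induction n with
  | zero =>
    let e := MvPolynomial.isEmptyRingEquiv C (Fin 0)
    have : RingHom.ker (φ.comp MvPolynomial.C) = (RingHom.ker φ).comap e.symm := by
      ext x
      rfl
    rw [this, RingEquiv.height_comap]
    simp
  | succ n ih =>
    let e := (MvPolynomial.finSuccEquiv C n).toRingEquiv
    let ψ : Polynomial (MvPolynomial (Fin n) C) →+* κ := φ.comp e.symm.toRingHom
    have hC : (ψ.comp Polynomial.C).comp MvPolynomial.C = φ.comp MvPolynomial.C := by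
      ext c
      have : e.symm (Polynomial.C (MvPolynomial.C c)) = MvPolynomial.C c := by
        rw [RingEquiv.symm_apply_eq]
        exact ((MvPolynomial.finSuccEquiv_apply C n _).trans (by simp)).symm
      simp [ψ, this]
    have h1 := ih (ψ.comp Polynomial.C) (by rw [hC]; exact hφ)
    have hs' : Function.Surjective (ψ.comp Polynomial.C) := fun y => by
      obtain ⟨c, hc⟩ := hφ y
      exact ⟨MvPolynomial.C c, by rw [← hc, ← hC]; rfl⟩
    have hs : Function.Surjective ψ := fun y => by
      obtain ⟨c, hc⟩ := hs' y
      exact ⟨Polynomial.C c, hc⟩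
    have : (RingHom.ker ψ).IsMaximal := RingHom.ker_isMaximal_of_surjective _ hs
    have : (RingHom.ker ψ).LiesOver (RingHom.ker (ψ.comp Polynomial.C)) := ⟨rfl⟩
    have h2 := Polynomial.height_eq_height_add_one (RingHom.ker (ψ.comp Polynomial.C))
      (RingHom.ker ψ)
    rw [hC] at h1
    have h3 : RingHom.ker ψ = (RingHom.ker φ).comap e.symm := by
      ext x
      rfl
    rw [h3, RingEquiv.height_comap] at h2
    rw [h2, h1]
    push_cast
    ring

/-! ### Localizations of polynomial rings -/

/-- A `k`-algebra `D` is essentially generated by the family `d` if every element of `D` is a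
fraction of two polynomials in `d`, the denominator being a unit of `D`. -/
def EssGenBy (k : Type*) {D ι : Type*} [CommRing k] [CommRing D] [Algebra k D] (d : ι → D) : Prop :=
  ∀ y, ∃ a s : MvPolynomial ι k, IsUnit (aeval d s) ∧ y * aeval d s = aeval d a

section

variable {k : Type*} [CommRing k] {ι : Type*}

theorem EssGenBy.of_surjective {D D' : Type*} [CommRing D] [Algebra k D] [CommRing D']
    [Algebra k D'] {d : ι → D} (hd : EssGenBy k d) (φ : D →ₐ[k] D') (hφ : Function.Surjective φ) :
    EssGenBy k (fun i => φ (d i)) := by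
  intro y
  obtain ⟨y, rfl⟩ := hφ y
  obtain ⟨a, s, hs, h⟩ := hd y
  have e (f : MvPolynomial ι k) : aeval (fun i => φ (d i)) f = φ (aeval d f) :=
    (comp_aeval_apply d φ f).symm
  exact ⟨a, s, by rw [e]; exact hs.map φ, by rw [e, e, ← h, map_mul]⟩

/-- The fractions of polynomials in `d` with unit denominators form a subalgebra. -/
def essClosure {D : Type*} [CommRing D] [Algebra k D] (d : ι → D) : Subalgebra k D where
  carrier := {y | ∃ a s : MvPolynomial ι k, IsUnit (aeval d s) ∧ y * aeval d s = aeval d a}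
  mul_mem' := by
    rintro x y ⟨a, s, hs, h⟩ ⟨b, t, ht, h'⟩
    exact ⟨a * b, s * t, by rw [map_mul]; exact hs.mul ht, by
      rw [map_mul, map_mul, ← h, ← h']; ring⟩
  add_mem' := by
    rintro x y ⟨a, s, hs, h⟩ ⟨b, t, ht, h'⟩
    exact ⟨a * t + b * s, s * t, by rw [map_mul]; exact hs.mul ht, by
      rw [map_mul, map_add, map_mul, map_mul, ← h, ← h']; ring⟩
  algebraMap_mem' r := ⟨C r, 1, by simp, by simp⟩

theorem aeval_mem_essClosure {D : Type*} [CommRing D] [Algebra k D] (d : ι → D)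
    (f : MvPolynomial ι k) : aeval d f ∈ essClosure (k := k) d :=
  ⟨f, 1, by simp, by simp⟩

/-- The fractions of polynomials in `d` are closed under division by units of `D`. -/
theorem mem_essClosure_of_mul_eq {D : Type*} [CommRing D] [Algebra k D] {d : ι → D} {x y z : D}
    (hx : x ∈ essClosure (k := k) d) (hz : z ∈ essClosure (k := k) d) (hu : IsUnit x)
    (h : y * x = z) : y ∈ essClosure (k := k) d := by
  obtain ⟨a, s, hs, hxa⟩ := hx
  obtain ⟨b, t, ht, hzb⟩ := hz
  refine ⟨b * s, t * a, ?_, ?_⟩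
  · rw [map_mul, ← hxa]
    exact ht.mul (hu.mul hs)
  · rw [map_mul, map_mul, ← hxa, ← hzb, ← h]
    ring

/-- The images in `T` of the variables. -/
noncomputable def coordVar (k T : Type*) {ι : Type*} [CommRing k] [CommRing T]
    [Algebra (MvPolynomial ι k) T] (i : ι) : T :=
  algebraMap (MvPolynomial ι k) T (X i)

theorem algebraMap_eq_aeval {T : Type*} [CommRing T] [Algebra k T] [Algebra (MvPolynomial ι k) T]
    [IsScalarTower k (MvPolynomial ι k) T]
    (f : MvPolynomial ι k) :
    algebraMap (MvPolynomial ι k) T f = aeval (coordVar k T) f := by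
  have : IsScalarTower.toAlgHom k (MvPolynomial ι k) T = aeval (coordVar k T) := by
    ext i
    simp [coordVar]
  exact DFunLike.congr_fun this f

theorem essGenBy_coordVar {T : Type*} [CommRing T] [Algebra k T] [Algebra (MvPolynomial ι k) T]
    [IsScalarTower k (MvPolynomial ι k) T] (P : Ideal (MvPolynomial ι k)) [P.IsPrime]
    [IsLocalization.AtPrime T P] :
    EssGenBy k (coordVar k T : ι → T) := by
  intro y
  obtain ⟨⟨a, s⟩, h⟩ := IsLocalization.surj P.primeCompl y
  refine ⟨a, s, ?_, ?_⟩
  · rw [← algebraMap_eq_aeval]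
    exact IsLocalization.map_units T s
  · rw [← algebraMap_eq_aeval, ← algebraMap_eq_aeval]
    exact h

theorem algHom_ext_coordVar {T : Type*} [CommRing T] [Algebra k T] [Algebra (MvPolynomial ι k) T]
    [IsScalarTower k (MvPolynomial ι k) T] (P : Ideal (MvPolynomial ι k)) [P.IsPrime]
    [IsLocalization.AtPrime T P]
    {D : Type*} [CommRing D] [Algebra k D] {φ ψ : T →ₐ[k] D}
    (h : ∀ i : ι, φ (coordVar k T i) = ψ (coordVar k T i)) : φ = ψ := by
  have : (φ : T →+* D) = ψ := by
    apply IsLocalization.ringHom_ext P.primeCompl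
    apply MvPolynomial.ringHom_ext
    · intro r
      have : algebraMap (MvPolynomial ι k) T (C r) = algebraMap k T r :=
        (IsScalarTower.algebraMap_apply k (MvPolynomial ι k) T r).symm
      simp [this]
    · intro i
      exact h i
  ext x
  exact DFunLike.congr_fun this x

/-- A homomorphism from the local ring `T` of an affine space to `D` may be prescribed on the variables
as soon as its reduction to `κ` agrees there with that of `T`: since `D → κ` is local, polynomials
outside `P` become units of `D`. -/
theorem exists_lift_coordVar {T : Type*} [CommRing T] [Algebra k T] [Algebra (MvPolynomial ι k) T]
    [IsScalarTower k (MvPolynomial ι k) T] (P : Ideal (MvPolynomial ι k)) [P.IsPrime]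
    [IsLocalization.AtPrime T P]
    {D κ : Type*} [CommRing D] [Algebra k D] [CommRing κ] [Algebra k κ]
    (r : D →ₐ[k] κ) [IsLocalHom r] (d : ι → D) (t : T →ₐ[k] κ) [IsLocalHom t]
    (h : ∀ i, r (d i) = t (coordVar k T i)) :
    ∃ φ : T →ₐ[k] D, (∀ i, φ (coordVar k T i) = d i) ∧ r.comp φ = t := by
  have hu (s : P.primeCompl) : IsUnit (aeval d (s : MvPolynomial ι k)) := by
    apply isUnit_of_map_unit r
    have : r (aeval d (s : MvPolynomial ι k)) = t (aeval (coordVar k T) (s : MvPolynomial ι k)) := by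
      rw [comp_aeval_apply, comp_aeval_apply]
      simp only [h]
    rw [this, ← algebraMap_eq_aeval]
    exact (IsLocalization.map_units T s).map t
  let φ : T →ₐ[k] D :=
    { IsLocalization.lift (M := P.primeCompl) (g := (aeval d : _ →ₐ[k] D).toRingHom) hu with
      commutes' := fun c => by
        have : algebraMap k T c = algebraMap (MvPolynomial ι k) T (C c) :=
          IsScalarTower.algebraMap_apply k (MvPolynomial ι k) T c
        change IsLocalization.lift (M := P.primeCompl)
          (g := (aeval d : _ →ₐ[k] D).toRingHom) hu _ = _
        rw [this, IsLocalization.lift_eq]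
        simp }
  have hφ (i) : φ (coordVar k T i) = d i := by
    change IsLocalization.lift (M := P.primeCompl) (g := (aeval d : _ →ₐ[k] D).toRingHom) hu _ = _
    rw [coordVar, IsLocalization.lift_eq]
    simp
  exact ⟨φ, hφ, algHom_ext_coordVar P fun i => by simp [hφ, h]⟩

/-- A local homomorphism whose image essentially generates the target is surjective, as the
denominators are images of units. -/
theorem surjective_of_essGenBy {T D : Type*} [CommRing T] [Algebra k T] [CommRing D] [Algebra k D]
    (φ : T →ₐ[k] D) [IsLocalHom φ] (d : ι → T) (h : EssGenBy k (fun i => φ (d i))) :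
    Function.Surjective φ := by
  intro y
  obtain ⟨a, s, hs, h⟩ := h y
  have e (f : MvPolynomial ι k) : aeval (fun i => φ (d i)) f = φ (aeval d f) :=
    (comp_aeval_apply d φ f).symm
  rw [e] at hs h
  rw [e] at h
  obtain ⟨v, hv⟩ := isUnit_of_map_unit φ _ hs
  refine ⟨aeval d a * ↑v⁻¹, ?_⟩
  rw [map_mul, ← h, ← hv, mul_assoc, ← map_mul]
  simp

/-- The kernel of a retraction of `T` onto a `k`-algebra `R`, with section `σ`, is generated by the
differences between the variables and their images in `R`. -/
theorem ker_eq_span_of_section {T : Type*} [CommRing T] [Algebra k T] [Algebra (MvPolynomial ι k) T]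
    [IsScalarTower k (MvPolynomial ι k) T] (P : Ideal (MvPolynomial ι k)) [P.IsPrime]
    [IsLocalization.AtPrime T P]
    {R : Type*} [CommRing R] [Algebra k R] (ρ : T →ₐ[k] R) (σ : R →ₐ[k] T)
    (h : ρ.comp σ = AlgHom.id k R) :
    RingHom.ker ρ =
      Ideal.span (Set.range fun i : ι => (coordVar k T i : T) - σ (ρ (coordVar k T i))) := by
  apply le_antisymm
  · intro t ht
    set L := Ideal.span (Set.range fun i : ι => (coordVar k T i : T) - σ (ρ (coordVar k T i)))
    have : Ideal.Quotient.mkₐ k L = ((Ideal.Quotient.mkₐ k L).comp σ).comp ρ := by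
      refine algHom_ext_coordVar P fun i => ?_
      exact (Ideal.Quotient.eq).mpr (Ideal.subset_span ⟨i, rfl⟩)
    have ht' : ρ t = 0 := ht
    have := DFunLike.congr_fun this t
    rw [AlgHom.comp_apply, ht', map_zero] at this
    exact Ideal.Quotient.eq_zero_iff_mem.mp this
  · rw [Ideal.span_le]
    rintro _ ⟨i, rfl⟩
    have := DFunLike.congr_fun h (ρ (coordVar k T i))
    simp only [AlgHom.comp_apply, AlgHom.id_apply] at this
    simp [RingHom.mem_ker, this]

end

/-! ### Dimension counts -/

theorem ringKrullDim_le_add_card_of_surjective {T B : Type*} [CommRing T] [IsLocalRing T]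
    [IsNoetherianRing T] [CommRing B] [Nontrivial B] (β : T →+* B) (hβ : Function.Surjective β)
    (G : Finset T) (hG : Ideal.span (G : Set T) = RingHom.ker β) :
    ringKrullDim T ≤ ringKrullDim B + G.card := by
  have h : (G : Set T) ⊆ maximalIdeal T := by
    rw [← Ideal.span_le, hG]
    exact le_maximalIdeal (RingHom.ker_ne_top β)
  rw [← ringJacobson_eq_maximalIdeal] at h
  refine (ringKrullDim_le_ringKrullDim_quotient_add_card G h).trans_eq ?_
  rw [hG, ringKrullDim_eq_of_ringEquiv (RingHom.quotientKerEquivOfSurjective hβ)]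

theorem ringKrullDim_quotient_le_add_card {T B : Type*} [CommRing T] [IsLocalRing T]
    [IsNoetherianRing T] [CommRing B] [Nontrivial B] (β : T →+* B) (hβ : Function.Surjective β)
    (F : Set T) (G : Finset T) (hG : Ideal.span (F ∪ G) = RingHom.ker β) :
    ringKrullDim (T ⧸ Ideal.span F) ≤ ringKrullDim B + G.card := by
  classical
  have hF : Ideal.span F ≤ RingHom.ker β := hG ▸ Ideal.span_mono Set.subset_union_left
  have : Nontrivial (T ⧸ Ideal.span F) :=
    Ideal.Quotient.nontrivial_iff.mpr fun h => RingHom.ker_ne_top β (top_le_iff.mp (h ▸ hF))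
  have : IsLocalRing (T ⧸ Ideal.span F) :=
    IsLocalRing.of_surjective' (Ideal.Quotient.mk _) Ideal.Quotient.mk_surjective
  have key := ringKrullDim_le_add_card_of_surjective (Ideal.Quotient.lift (Ideal.span F) β hF)
    (Ideal.Quotient.lift_surjective_of_surjective _ hF hβ)
    (G.image (Ideal.Quotient.mk (Ideal.span F))) (by
      rw [Ideal.ker_quotient_lift, ← hG, Ideal.map_span, Set.image_union, Ideal.span_union,
        Finset.coe_image]
      refine (sup_eq_right.mpr ?_).symm
      rw [Ideal.span_le]
      rintro _ ⟨x, hx, rfl⟩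
      rw [Ideal.Quotient.eq_zero_iff_mem.mpr (Ideal.subset_span hx)]
      exact Ideal.zero_mem _)
  refine key.trans ?_
  gcongr
  exact Finset.card_image_le

theorem exists_ringKrullDim_eq_natCast (R : Type*) [CommRing R] [IsLocalRing R]
    [IsNoetherianRing R] : ∃ d : ℕ, ringKrullDim R = d := by
  have h := ringKrullDim_ne_top (R := R)
  have h' := ringKrullDim_ne_bot (R := R)
  generalize ringKrullDim R = x at *
  induction x with
  | bot => exact absurd rfl h'
  | coe x =>
    induction x with
    | top => exact absurd rfl h
    | coe x => exact ⟨x, rfl⟩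

/-- A homomorphism to a field factors through the localization at its kernel, by a local
homomorphism. -/
theorem exists_localization_ker_lift {k S κ : Type*} [CommRing k] [CommRing S] [Algebra k S]
    [Field κ] [Algebra k κ] (φ : S →ₐ[k] κ) (P : Ideal S) [P.IsPrime] (hP : P = RingHom.ker φ) :
    ∃ t : Localization.AtPrime P →ₐ[k] κ, IsLocalHom t ∧ ∀ x, t (algebraMap _ _ x) = φ x := by
  have hu (y : P.primeCompl) : IsUnit (φ y) := by
    rw [isUnit_iff_ne_zero]
    intro h
    exact y.2 (hP ▸ h)
  refine ⟨IsLocalization.liftAlgHom (M := P.primeCompl) (f := φ) hu, ⟨fun y hy => ?_⟩,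
    fun x => by simp⟩
  obtain ⟨a, s, rfl⟩ := IsLocalization.exists_mk'_eq P.primeCompl y
  rw [IsLocalization.AtPrime.isUnit_mk'_iff _ P]
  intro ha
  have ha : φ a = 0 := by rw [hP] at ha; exact ha
  simp [IsLocalization.lift_mk', ha] at hy

/-- Let `C` be a local ring essentially generated by `c₁, …, cₙ`, and let `T` be the local ring of
`𝔸ⁿ⁺ᴺ` over `k` at the kernel of the evaluation in `κ` at the residues of the `cᵢ` and at `e`. Then
`T` maps onto the local ring `D` of `𝔸ᴺ` over `C` at the point `e`, whose dimension is at least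
`dim C + N`. The bijection `ε` says which variables of `T` correspond to the `cᵢ`. -/
theorem exists_surjective_and_ringKrullDim_ge {k : Type*} [CommRing k] {n N : ℕ} {ι : Type*}
    {C : Type u} {κ T : Type*} [CommRing C] [IsNoetherianRing C] [IsLocalRing C] [Algebra k C]
    [Field κ] [Algebra k κ]
    (r : C →ₐ[k] κ) [IsLocalHom r] (hr : Function.Surjective r) (c : Fin n → C)
    (hc : EssGenBy k c) (e : Fin N → κ)
    [CommRing T] [Algebra k T] [Algebra (MvPolynomial ι k) T]
    [IsScalarTower k (MvPolynomial ι k) T] (P : Ideal (MvPolynomial ι k)) [P.IsPrime]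
    [IsLocalization.AtPrime T P] (t : T →ₐ[k] κ) [IsLocalHom t] (ε : ι ≃ Fin n ⊕ Fin N)
    (h : ∀ i, t (coordVar k T i) = (ε i).elim (fun a => r (c a)) e) :
    ∃ (D : Type u) (_ : CommRing D) (_ : Algebra k D) (φ : T →ₐ[k] D) (j : C →ₐ[k] D),
      Function.Surjective φ ∧ (∀ a, φ (coordVar k T (ε.symm (Sum.inl a))) = j (c a)) ∧
      ringKrullDim C + N ≤ ringKrullDim D := by
  let φ₀ : MvPolynomial (Fin N) C →ₐ[k] κ := aevalTower r e
  let P' : Ideal (MvPolynomial (Fin N) C) := RingHom.ker φ₀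
  have : P'.IsPrime := RingHom.ker_isPrime _
  let D := Localization.AtPrime P'
  obtain ⟨r', hr', hr''⟩ := exists_localization_ker_lift φ₀ P' rfl
  let inc : MvPolynomial (Fin N) C →ₐ[k] D := IsScalarTower.toAlgHom k _ D
  let j : C →ₐ[k] D := inc.comp (IsScalarTower.toAlgHom k C (MvPolynomial (Fin N) C))
  have hj (y : C) : j y = inc (MvPolynomial.C y) := rfl
  let d : ι → D := fun i => (ε i).elim (fun a => j (c a)) fun b => inc (X b)
  obtain ⟨φ, hφ, hφt⟩ := exists_lift_coordVar P r' d t fun i => by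
    rw [h]
    rcases hi : ε i with a | b
    · simp only [d, hi, Sum.elim_inl, hj]
      exact (hr'' _).trans (by simp [φ₀])
    · simp only [d, hi, Sum.elim_inr]
      exact (hr'' _).trans (by simp [φ₀])
  have hloc : IsLocalHom φ := ⟨fun a ha => by
    have : IsUnit (r' (φ a)) := ha.map r'
    rw [← AlgHom.comp_apply, hφt] at this
    exact isUnit_of_map_unit t _ this⟩
  have hdl (a) : d (ε.symm (Sum.inl a)) = j (c a) := by simp [d]
  have hdr (b) : d (ε.symm (Sum.inr b)) = inc (X b) := by simp [d]
  have hmem (f : MvPolynomial ι k) := aeval_mem_essClosure (k := k) d f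
  have hjmem (y : C) : j y ∈ essClosure (k := k) d := by
    obtain ⟨a, s, hs, hy⟩ := hc y
    have e (f : MvPolynomial (Fin n) k) : j (aeval c f) ∈ essClosure (k := k) d := by
      have : j (aeval c f) = aeval d (rename (fun a => ε.symm (Sum.inl a)) f) := by
        rw [aeval_rename, comp_aeval_apply]
        congr 2
        ext a
        exact (hdl a).symm
      rw [this]
      exact hmem _
    exact mem_essClosure_of_mul_eq (e s) (e a) (hs.map j) (by rw [← hy, map_mul])
  have hinc (f : MvPolynomial (Fin N) C) : inc f ∈ essClosure (k := k) d := by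
    induction f using MvPolynomial.induction_on with
    | C y => exact hjmem y
    | add f g hf hg => rw [map_add]; exact add_mem hf hg
    | mul_X f b hf =>
      rw [map_mul]
      refine mul_mem hf ?_
      have := hmem (X (ε.symm (Sum.inr b)))
      rwa [aeval_X, hdr] at this
  have hess : EssGenBy k d := fun y => by
    obtain ⟨⟨a, s⟩, hy⟩ := IsLocalization.surj P'.primeCompl y
    exact mem_essClosure_of_mul_eq (hinc s) (hinc a) (IsLocalization.map_units D s) hy
  refine ⟨D, inferInstance, inferInstance, φ, j, ?_, fun a => ?_, ?_⟩
  · refine surjective_of_essGenBy φ (coordVar k T : ι → T) ?_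
    simpa only [hφ] using hess
  · rw [hφ, hdl]
  · have hcomp : (φ₀ : MvPolynomial (Fin N) C →+* κ).comp MvPolynomial.C = r := by
      ext y
      simp [φ₀]
    have h1 := height_ker_mvPolynomial N (φ₀ : MvPolynomial (Fin N) C →+* κ)
      (by rw [hcomp]; exact hr)
    have h2 : RingHom.ker (r : C →+* κ) = maximalIdeal C := by
      ext x
      rw [RingHom.mem_ker, mem_maximalIdeal, mem_nonunits_iff, ← isUnit_map_iff r,
        isUnit_iff_ne_zero, not_not]
      rfl
    have h3 : RingHom.ker (φ₀ : MvPolynomial (Fin N) C →+* κ) = P' := rfl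
    rw [hcomp, h2, h3] at h1
    rw [IsLocalization.AtPrime.ringKrullDim_eq_height P' D, h1,
      ← IsLocalRing.maximalIdeal_height_eq_ringKrullDim]
    push_cast
    rfl

/-! ### Retracts of complete intersection rings -/

/-- If `A` is a retract of `B` over `k` and `B = R₂ / J` with `J` generated by `dim R₂ - dim B`
elements, then in every presentation `A = R₁ / I` the ideal `I` is generated by `dim R₁ - dim A`
elements. Here `R₁` and `R₂` are local rings of affine spaces over `k`. -/
theorem exists_generators_of_retract {k : Type*} [Field k] {n N c : ℕ} {R₁ R₂ A B : Type*}
    [CommRing R₁] [CommRing R₂] [CommRing A] [CommRing B] [IsLocalRing A] [IsLocalRing B]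
    [Algebra k R₁] [Algebra k R₂] [Algebra k A] [Algebra k B]
    [Algebra (MvPolynomial (Fin n) k) R₁] [IsScalarTower k (MvPolynomial (Fin n) k) R₁]
    [Algebra (MvPolynomial (Fin N) k) R₂] [IsScalarTower k (MvPolynomial (Fin N) k) R₂]
    (p₁ : Ideal (MvPolynomial (Fin n) k)) [p₁.IsPrime] [IsLocalization.AtPrime R₁ p₁]
    (p₂ : Ideal (MvPolynomial (Fin N) k)) [p₂.IsPrime] [IsLocalization.AtPrime R₂ p₂]
    (α₁ : R₁ →ₐ[k] A) (hα₁ : Function.Surjective α₁)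
    (α₂ : R₂ →ₐ[k] B) (hα₂ : Function.Surjective α₂)
    (s : A →ₐ[k] B) (π : B →ₐ[k] A) [IsLocalHom π] (hπs : π.comp s = AlgHom.id k A)
    (g : Fin c → R₂) (hg : Ideal.span (Set.range g) = RingHom.ker α₂)
    (hc : ringKrullDim B + c = ringKrullDim R₂) :
    ∃ (r : ℕ) (f : Fin r → R₁), Ideal.span (Set.range f) = RingHom.ker α₁ ∧
      ringKrullDim A + r = ringKrullDim R₁ := by
  classical
  have : IsLocalRing R₁ := IsLocalization.AtPrime.isLocalRing R₁ p₁
  have : IsLocalRing R₂ := IsLocalization.AtPrime.isLocalRing R₂ p₂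
  have : IsNoetherianRing R₁ := IsLocalization.isNoetherianRing p₁.primeCompl R₁ inferInstance
  have : IsNoetherianRing R₂ := IsLocalization.isNoetherianRing p₂.primeCompl R₂ inferInstance
  have : IsNoetherianRing A := isNoetherianRing_of_surjective R₁ A α₁.toRingHom hα₁
  have : IsNoetherianRing B := isNoetherianRing_of_surjective R₂ B α₂.toRingHom hα₂
  have hπs' (a : A) : π (s a) = a := DFunLike.congr_fun hπs a
  have hα₁l : IsLocalHom α₁.toRingHom := IsLocalHom.of_surjective _ hα₁
  have hα₂l : IsLocalHom α₂.toRingHom := IsLocalHom.of_surjective _ hα₂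
  let res : A →ₐ[k] ResidueField A := IsScalarTower.toAlgHom k A (ResidueField A)
  have hres : Function.Surjective res := residue_surjective
  have hresl : IsLocalHom res := ⟨fun a ha => isUnit_of_map_unit (residue A) a ha⟩
  let r₁ : R₁ →ₐ[k] ResidueField A := res.comp α₁
  let r₂ : R₂ →ₐ[k] ResidueField A := res.comp (π.comp α₂)
  have hr₁ : IsLocalHom r₁ :=
    ⟨fun a ha => isUnit_of_map_unit α₁.toRingHom a (isUnit_of_map_unit res _ ha)⟩
  have hr₂ : IsLocalHom r₂ := ⟨fun a ha =>
    isUnit_of_map_unit α₂.toRingHom a (isUnit_of_map_unit π _ (isUnit_of_map_unit res _ ha))⟩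
  -- `T` is the local ring of the product of the two affine spaces at the point over both closed
  -- points whose residue field is that of `A`.
  let e : Fin n ⊕ Fin N → ResidueField A :=
    Sum.elim (fun i => r₁ (coordVar k R₁ i)) fun i => r₂ (coordVar k R₂ i)
  let P : Ideal (MvPolynomial (Fin n ⊕ Fin N) k) := RingHom.ker (aeval (R := k) e)
  have hP : P.IsPrime := RingHom.ker_isPrime _
  obtain ⟨T, _, _, _, _, _, t, htl, ht⟩ : ∃ (T : Type _) (_ : CommRing T) (_ : Algebra k T)
      (_ : Algebra (MvPolynomial (Fin n ⊕ Fin N) k) T)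
      (_ : IsScalarTower k (MvPolynomial (Fin n ⊕ Fin N) k) T)
      (_ : IsLocalization.AtPrime T P) (t : T →ₐ[k] ResidueField A),
      IsLocalHom t ∧ ∀ i, t (coordVar k T i) = e i := by
    obtain ⟨t, htl, ht⟩ := exists_localization_ker_lift (aeval (R := k) e) P rfl
    exact ⟨Localization.AtPrime P, inferInstance, inferInstance, inferInstance, inferInstance,
      inferInstance, t, htl, fun i => (ht _).trans (by simp)⟩
  have : IsLocalRing T := IsLocalization.AtPrime.isLocalRing T P
  have : IsNoetherianRing T := IsLocalization.isNoetherianRing P.primeCompl T inferInstance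
  choose h hh using fun j : Fin N => hα₁ (π (α₂ (coordVar k R₂ j)))
  choose q hq using fun i : Fin n => hα₂ (s (α₁ (coordVar k R₁ i)))
  obtain ⟨ρ₁, hρ₁, hρ₁t⟩ := exists_lift_coordVar P r₁
    (Sum.elim (fun i => coordVar k R₁ i) h) t (by
      rintro (i | j)
      · rw [ht]; rfl
      · rw [ht]; simp [r₁, r₂, e, hh])
  obtain ⟨ρ₂, hρ₂, hρ₂t⟩ := exists_lift_coordVar P r₂
    (Sum.elim q fun j => coordVar k R₂ j) t (by
      rintro (i | j)
      · rw [ht]; simp [r₁, r₂, e, hq, hπs']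
      · rw [ht]; rfl)
  obtain ⟨σ₁, hσ₁, -⟩ := exists_lift_coordVar p₁ t (fun i => coordVar k T (Sum.inl i)) r₁
    fun i => ht _
  obtain ⟨σ₂, hσ₂, -⟩ := exists_lift_coordVar p₂ t (fun i => coordVar k T (Sum.inr i)) r₂
    fun i => ht _
  have hρσ₁ : ρ₁.comp σ₁ = AlgHom.id k R₁ := algHom_ext_coordVar p₁ fun i => by
    simp [hσ₁, hρ₁]
  have hρσ₂ : ρ₂.comp σ₂ = AlgHom.id k R₂ := algHom_ext_coordVar p₂ fun i => by
    simp [hσ₂, hρ₂]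
  have hρσ₁' (x) : ρ₁ (σ₁ x) = x := DFunLike.congr_fun hρσ₁ x
  have hρσ₂' (x) : ρ₂ (σ₂ x) = x := DFunLike.congr_fun hρσ₂ x
  let β : T →ₐ[k] B := α₂.comp ρ₂
  have hβ : Function.Surjective β := fun y => by
    obtain ⟨x, rfl⟩ := hα₂ y
    exact ⟨σ₂ x, by simp [β, hρσ₂']⟩
  have hβσ : β.comp σ₁ = s.comp α₁ := algHom_ext_coordVar p₁ fun i => by
    simp [β, hσ₁, hρ₂, hq]
  have hαρ : α₁.comp ρ₁ = π.comp β := algHom_ext_coordVar P (by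
    rintro (i | j)
    · simp [β, hρ₁, hρ₂, hq, hπs']
    · simp [β, hρ₁, hρ₂, hh])
  have hβσ' (x) : β (σ₁ x) = s (α₁ x) := DFunLike.congr_fun hβσ x
  have hαρ' (x) : α₁ (ρ₁ x) = π (β x) := DFunLike.congr_fun hαρ x
  -- The kernel of `T → B` is generated by `n + c` elements.
  have hK : Ideal.span (Set.range (Sum.elim
      (fun i => coordVar k T (Sum.inl i : Fin n ⊕ Fin N) - σ₂ (q i)) (fun j => σ₂ (g j)) ∘
        finSumFinEquiv.symm : Fin (n + c) → T)) = RingHom.ker β := by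
    rw [finSumFinEquiv.symm.surjective.range_comp, Set.Sum.elim_range, Ideal.span_union]
    apply le_antisymm
    · rw [sup_le_iff, Ideal.span_le, Ideal.span_le]
      constructor
      · rintro _ ⟨i, rfl⟩
        simp [RingHom.mem_ker, β, hρ₂, hρσ₂']
      · rintro _ ⟨j, rfl⟩
        have : g j ∈ RingHom.ker α₂ := hg ▸ Ideal.subset_span ⟨j, rfl⟩
        simpa [RingHom.mem_ker, β, hρσ₂'] using this
    · intro x hx
      have h1 : x - σ₂ (ρ₂ x) ∈ RingHom.ker ρ₂ := by simp [RingHom.mem_ker, hρσ₂']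
      have h2 : ρ₂ x ∈ RingHom.ker α₂ := hx
      rw [ker_eq_span_of_section P ρ₂ σ₂ hρσ₂] at h1
      rw [← sub_add_cancel x (σ₂ (ρ₂ x))]
      refine Ideal.add_mem _ (Ideal.mem_sup_left ?_) (Ideal.mem_sup_right ?_)
      · refine Ideal.span_le.mpr ?_ h1
        rintro _ ⟨i | j, rfl⟩
        · exact Ideal.subset_span ⟨i, by simp [hρ₂]⟩
        · simp [hρ₂, hσ₂]
      · have := Ideal.mem_map_of_mem σ₂ h2
        rw [← hg, Ideal.map_span, ← Set.range_comp] at this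
        exact this
  obtain ⟨r, f, hf, hfi⟩ := exists_minimal_generators (RingHom.ker α₁)
  have hfα (i) : α₁ (f i) = 0 := by
    have : f i ∈ RingHom.ker α₁ := hf ▸ Ideal.subset_span ⟨i, rfl⟩
    exact this
  have hρ₁l : IsLocalHom ρ₁ := ⟨fun a ha => by
    have : IsUnit (r₁ (ρ₁ a)) := ha.map r₁
    rw [← AlgHom.comp_apply, hρ₁t] at this
    exact isUnit_of_map_unit t _ this⟩
  -- Applying the retraction `ρ₁`, minimal generators of `ker α₁` stay independent modulo `𝔪 K`.
  obtain ⟨G, hGc, hG⟩ := exists_generators_extending (f := fun i => σ₁ (f i)) hK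
    (fun i => by rw [RingHom.mem_ker, hβσ', hfα, map_zero]) (by
      intro a ha i
      have hle : (maximalIdeal T * RingHom.ker β).map ρ₁ ≤ maximalIdeal R₁ * RingHom.ker α₁ := by
        rw [Ideal.map_mul]
        refine Ideal.mul_mono ?_ ?_
        · rw [Ideal.map_le_iff_le_comap]
          intro x hx hu
          exact hx (isUnit_of_map_unit ρ₁ x hu)
        · rw [Ideal.map_le_iff_le_comap]
          intro x hx
          have hx : β x = 0 := hx
          rw [Ideal.mem_comap, RingHom.mem_ker, hαρ', hx, map_zero]
      have := hfi (fun i => ρ₁ (a i)) (by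
        have := hle (Ideal.mem_map_of_mem ρ₁ ha)
        simpa [map_sum, hρσ₁'] using this) i
      exact fun hu => this (hu.map ρ₁))
  refine ⟨r, f, hf, ?_⟩
  have d1 := ringKrullDim_quotient_le_add_card β.toRingHom hβ _ G hG
  have d2 : ringKrullDim A + N ≤
      ringKrullDim (T ⧸ Ideal.span (Set.range fun i => σ₁ (f i))) := by
    have hA : EssGenBy k (fun i => α₁ (coordVar k R₁ i)) :=
      (essGenBy_coordVar p₁).of_surjective α₁ hα₁
    obtain ⟨D, _, _, φ, j, hφ, hφj, hD⟩ := exists_surjective_and_ringKrullDim_ge res hres _ hA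
      (fun j => r₂ (coordVar k R₂ j)) P t (Equiv.refl _) ht
    refine hD.trans (ringKrullDim_le_of_surjective
      (Ideal.Quotient.lift _ (φ : T →+* D) fun x hx => ?_)
      (Ideal.Quotient.lift_surjective_of_surjective _ _ hφ))
    have hφσ : φ.comp σ₁ = j.comp α₁ := algHom_ext_coordVar p₁ fun i => by
      simpa [hσ₁] using hφj i
    have : Ideal.span (Set.range fun i => σ₁ (f i)) ≤ RingHom.ker (φ : T →+* D) := by
      rw [Ideal.span_le]
      rintro _ ⟨i, rfl⟩
      have := DFunLike.congr_fun hφσ (f i)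
      simpa [hfα, RingHom.mem_ker] using this
    exact this hx
  have d3 : ringKrullDim R₂ + n ≤ ringKrullDim T := by
    obtain ⟨D, _, _, φ, j, hφ, -, hD⟩ := exists_surjective_and_ringKrullDim_ge r₂
      (fun y => by
        obtain ⟨a, rfl⟩ := hres y
        obtain ⟨x, hx⟩ := hα₂ (s a)
        exact ⟨x, by simp [r₂, hx, hπs']⟩) _ (essGenBy_coordVar p₂)
      (fun i => r₁ (coordVar k R₁ i)) P t (Equiv.sumComm _ _) (by
        rintro (i | j)
        · simp [ht, e]
        · simp [ht, e])
    exact hD.trans (ringKrullDim_le_of_surjective (φ : T →+* D) hφ)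
  have d4 : ringKrullDim T ≤ ringKrullDim R₁ + N := by
    refine (ringKrullDim_le_add_card_of_surjective ρ₁.toRingHom
      (fun x => ⟨σ₁ x, hρσ₁' x⟩)
      (Finset.univ.image fun j => coordVar k T (Sum.inr j : Fin n ⊕ Fin N) - σ₁ (h j)) ?_).trans ?_
    · change _ = RingHom.ker ρ₁
      rw [ker_eq_span_of_section P ρ₁ σ₁ hρσ₁]
      apply le_antisymm
      · refine Ideal.span_mono ?_
        intro x hx
        obtain ⟨j, rfl⟩ : ∃ j, coordVar k T (Sum.inr j : Fin n ⊕ Fin N) - σ₁ (h j) = x := by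
          simpa using hx
        exact ⟨Sum.inr j, by simp [hρ₁]⟩
      · rw [Ideal.span_le]
        rintro _ ⟨i | j, rfl⟩
        · simp [hρ₁, hσ₁]
        · exact Ideal.subset_span (by simp [hρ₁])
    · gcongr
      simpa using Finset.card_image_le (s := Finset.univ)
        (f := fun j => coordVar k T (Sum.inr j : Fin n ⊕ Fin N) - σ₁ (h j))
  have d5 : ringKrullDim R₁ ≤ ringKrullDim A + r := by
    refine (ringKrullDim_le_add_card_of_surjective α₁.toRingHom hα₁
      (Finset.univ.image f) ?_).trans ?_
    · rw [Finset.coe_image, Finset.coe_univ, Set.image_univ]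
      exact hf
    gcongr
    simpa using Finset.card_image_le (s := Finset.univ) (f := f)
  refine le_antisymm ?_ d5
  have d6 := d2.trans d1
  have d7 := d3.trans d4
  rw [← hc] at d7
  obtain ⟨a, ha⟩ := exists_ringKrullDim_eq_natCast A
  obtain ⟨b, hb⟩ := exists_ringKrullDim_eq_natCast B
  obtain ⟨m, hm⟩ := exists_ringKrullDim_eq_natCast R₁
  rw [ha, hb] at d6
  rw [hb, hm] at d7
  rw [ha, hm]
  norm_cast at d6 d7 ⊢
  omega

/-! ### Retracts of schemes -/

section

variable {k : Type u} [Field k]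

/-- The structure map `k ⟶ 𝒪_{X, x}` of the local ring of a `k`-scheme. -/
noncomputable def stalkScalar (X : Over (Spec (CommRingCat.of k))) (x : X.left) :
    CommRingCat.of k ⟶ X.left.presheaf.stalk x :=
  Spec.preimage (X.left.fromSpecStalk x ≫ X.hom)

theorem stalkScalar_comp {X Y : Over (Spec (CommRingCat.of k))} (f : X ⟶ Y) (x : X.left) :
    stalkScalar Y (f.left x) ≫ f.left.stalkMap x = stalkScalar X x := by
  apply Spec.map_injective
  rw [Spec.map_comp, stalkScalar, stalkScalar, Spec.map_preimage, Spec.map_preimage,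
    Scheme.SpecMap_stalkMap_fromSpecStalk_assoc, Over.w]

theorem stalkScalar_affineSpaceOver (n : ℕ) (z : (affineSpaceOver k n).left) :
    stalkScalar (affineSpaceOver k n) z = CommRingCat.ofHom MvPolynomial.C ≫
      StructureSheaf.toStalk (CommRingCat.of (MvPolynomial (Fin n) k)) z := by
  apply Spec.map_injective
  rw [stalkScalar, Spec.map_preimage]
  refine Eq.trans ?_ (Spec.map_comp _ _).symm
  exact congr($(AlgebraicGeometry.Spec.fromSpecStalk_eq' _ _) ≫ _)

/-- `exists_generators_of_retract` for stalks of affine spaces, in the category of commutative rings.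
The `k`-algebra structures enter through `hk`. -/
theorem exists_generators_of_stalk_retract {n N c : ℕ} (z₁ : (affineSpaceOver k n).left)
    (z₂ : (affineSpaceOver k N).left) {A B : CommRingCat.{u}} [IsLocalRing A] [IsLocalRing B]
    (α₁ : (affineSpaceOver k n).left.presheaf.stalk z₁ ⟶ A) (hα₁ : Function.Surjective α₁)
    (α₂ : (affineSpaceOver k N).left.presheaf.stalk z₂ ⟶ B) (hα₂ : Function.Surjective α₂)
    (s : A ⟶ B) (π : B ⟶ A) [IsLocalHom π.hom] (hπs : s ≫ π = 𝟙 A)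
    (hk : stalkScalar _ z₁ ≫ α₁ ≫ s = stalkScalar _ z₂ ≫ α₂)
    (g : Fin c → (affineSpaceOver k N).left.presheaf.stalk z₂)
    (hg : Ideal.span (Set.range g) = RingHom.ker α₂.hom)
    (hc : ringKrullDim B + c = ringKrullDim ((affineSpaceOver k N).left.presheaf.stalk z₂)) :
    ∃ (r : ℕ) (f : Fin r → (affineSpaceOver k n).left.presheaf.stalk z₁),
      Ideal.span (Set.range f) = RingHom.ker α₁.hom ∧
      ringKrullDim A + r = ringKrullDim ((affineSpaceOver k n).left.presheaf.stalk z₁) := by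
  let R₁ := (affineSpaceOver k n).left.presheaf.stalk z₁
  let R₂ := (affineSpaceOver k N).left.presheaf.stalk z₂
  let _ : Algebra k R₁ := (stalkScalar _ z₁).hom.toAlgebra
  let _ : Algebra k R₂ := (stalkScalar _ z₂).hom.toAlgebra
  let _ : Algebra k A := (stalkScalar _ z₁ ≫ α₁).hom.toAlgebra
  let _ : Algebra k B := (stalkScalar _ z₂ ≫ α₂).hom.toAlgebra
  let _ : Algebra (MvPolynomial (Fin n) k) R₁ :=
    (StructureSheaf.toStalk (CommRingCat.of (MvPolynomial (Fin n) k)) z₁).hom.toAlgebra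
  let _ : Algebra (MvPolynomial (Fin N) k) R₂ :=
    (StructureSheaf.toStalk (CommRingCat.of (MvPolynomial (Fin N) k)) z₂).hom.toAlgebra
  let p₁ : PrimeSpectrum (MvPolynomial (Fin n) k) := z₁
  let p₂ : PrimeSpectrum (MvPolynomial (Fin N) k) := z₂
  have : IsLocalization.AtPrime R₁ p₁.asIdeal :=
    StructureSheaf.IsLocalization.to_stalk (MvPolynomial (Fin n) k) p₁
  have : IsLocalization.AtPrime R₂ p₂.asIdeal :=
    StructureSheaf.IsLocalization.to_stalk (MvPolynomial (Fin N) k) p₂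
  have : IsScalarTower k (MvPolynomial (Fin n) k) R₁ :=
    .of_algebraMap_eq fun a => congr(($(stalkScalar_affineSpaceOver n z₁)).hom a)
  have : IsScalarTower k (MvPolynomial (Fin N) k) R₂ :=
    .of_algebraMap_eq fun a => congr(($(stalkScalar_affineSpaceOver N z₂)).hom a)
  let α₁' : R₁ →ₐ[k] A := { α₁.hom with commutes' := fun a => rfl }
  let α₂' : R₂ →ₐ[k] B := { α₂.hom with commutes' := fun a => rfl }
  let s' : A →ₐ[k] B := { s.hom with commutes' := fun a => congr(($hk).hom a) }
  have hπ : stalkScalar _ z₂ ≫ α₂ ≫ π = stalkScalar _ z₁ ≫ α₁ := by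
    rw [← reassoc_of% hk, hπs, Category.comp_id]
  let π' : B →ₐ[k] A := { π.hom with commutes' := fun a => congr(($hπ).hom a) }
  have : IsLocalHom π' := ⟨fun a ha => isUnit_of_map_unit π.hom a ha⟩
  exact exists_generators_of_retract p₁.asIdeal p₂.asIdeal α₁' hα₁ α₂' hα₂ s' π'
    (by ext a; exact congr(($hπs).hom a)) g hg hc

/-- Every point of a `k`-scheme locally of finite type has an open neighbourhood that is a closed
subscheme of an affine space. -/
theorem exists_isClosedImmersion_affineSpaceOver (X : Over (Spec (CommRingCat.of k)))
    [LocallyOfFiniteType X.hom] (x : X.left) :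
    ∃ (U : X.left.Opens) (_ : x ∈ U) (n : ℕ) (i : Over.mk (U.ι ≫ X.hom) ⟶ affineSpaceOver k n),
      IsClosedImmersion i.left := by
  obtain ⟨_, ⟨(U : X.left.Opens), hU, rfl⟩, hx, -⟩ :=
    X.left.isBasis_affineOpens.exists_subset_of_mem_open (Set.mem_univ x) isOpen_univ
  change IsAffineOpen U at hU
  have : IsAffine U := hU
  obtain ⟨b, hb⟩ := Spec.map_surjective (U.toScheme.isoSpec.inv ≫ U.ι ≫ X.hom)
  have hb' : U.toScheme.isoSpec.hom ≫ Spec.map b = U.ι ≫ X.hom := by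
    rw [hb, Iso.hom_inv_id_assoc]
  have hft : LocallyOfFiniteType (Spec.map b) := by
    rw [hb]
    infer_instance
  rw [HasRingHomProperty.Spec_iff (P := @LocallyOfFiniteType)] at hft
  let _ : Algebra k Γ(U, ⊤) := b.hom.toAlgebra
  have : Algebra.FiniteType k Γ(U, ⊤) := hft
  obtain ⟨n, f, hf⟩ := Algebra.FiniteType.iff_quotient_mvPolynomial''.mp this
  refine ⟨U, hx, n, Over.homMk (V := JetScheme.specOver k Γ(U, ⊤)) U.toScheme.isoSpec.hom hb' ≫
    JetScheme.specMap f, ?_⟩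
  have : IsClosedImmersion (Spec.map (CommRingCat.ofHom f.toRingHom)) :=
    IsClosedImmersion.spec_of_surjective _ hf
  exact inferInstanceAs (IsClosedImmersion (U.toScheme.isoSpec.hom ≫ Spec.map _))

/-- Named form of an instance, for stalks that match `𝒪_{Y, f x}` only after unfolding `f x`. -/
theorem isIso_stalkMap_of_isOpenImmersion {X Y : Scheme.{u}} (f : X ⟶ Y) [IsOpenImmersion f]
    (x : X) : IsIso (f.stalkMap x) :=
  inferInstance

theorem isLocalRing_stalk (X : Scheme.{u}) (x : X) : IsLocalRing (X.presheaf.stalk x) :=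
  inferInstance

theorem isLocalHom_stalkMap {X Y : Scheme.{u}} (f : X ⟶ Y) (x : X) :
    IsLocalHom (f.stalkMap x).hom :=
  inferInstance

/-- A retract of a `k`-scheme `Y` inherits from `Y` the property of being a complete intersection at
a point. -/
theorem isCompleteIntersectionAt_of_retract {X Y : Over (Spec (CommRingCat.of k))}
    [LocallyOfFiniteType X.hom] (σ : X ⟶ Y) (π : Y ⟶ X) (h : σ ≫ π = 𝟙 X) (x : X.left)
    (hY : IsCompleteIntersectionAt Y (σ.left x)) : IsCompleteIntersectionAt X x := by
  obtain ⟨V, hy, N, j, hj, c, g, hg, hc⟩ := hY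
  obtain ⟨U, hx, n, i, hi⟩ := exists_isClosedImmersion_affineSpaceOver X x
  refine ⟨U, hx, n, i, hi, ?_⟩
  let ιU : Over.mk (U.ι ≫ X.hom) ⟶ X := Over.homMk U.ι
  let ιV : Over.mk (V.ι ≫ Y.hom) ⟶ Y := Over.homMk V.ι
  let u : X.left.presheaf.stalk x ⟶ U.toScheme.presheaf.stalk ⟨x, hx⟩ := U.ι.stalkMap ⟨x, hx⟩
  let v : Y.left.presheaf.stalk (σ.left x) ⟶ V.toScheme.presheaf.stalk ⟨σ.left x, hy⟩ :=
    V.ι.stalkMap ⟨σ.left x, hy⟩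
  have hu : IsIso u := isIso_stalkMap_of_isOpenImmersion U.ι ⟨x, hx⟩
  have hv : IsIso v := isIso_stalkMap_of_isOpenImmersion V.ι ⟨σ.left x, hy⟩
  have hs : stalkScalar X x ≫ u = stalkScalar (Over.mk (U.ι ≫ X.hom)) ⟨x, hx⟩ :=
    stalkScalar_comp ιU ⟨x, hx⟩
  have hs' : stalkScalar Y (σ.left x) ≫ v =
      stalkScalar (Over.mk (V.ι ≫ Y.hom)) ⟨σ.left x, hy⟩ := stalkScalar_comp ιV ⟨σ.left x, hy⟩
  -- The points `π (σ x)` and `x` are equal only propositionally, so their local rings are identified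
  -- by inverting `ε` instead of transporting along the equality.
  let ε := π.left.stalkMap (σ.left x) ≫ σ.left.stalkMap x
  have hε : IsIso ε := by
    have e : ε = (σ.left ≫ π.left).stalkMap x := (Scheme.Hom.stalkMap_comp _ _ _).symm
    have : IsIso (σ.left ≫ π.left) := by
      have e' : σ.left ≫ π.left = 𝟙 X.left := congr(($h).left)
      rw [e']
      infer_instance
    rw [e]
    exact isIso_stalkMap_of_isOpenImmersion _ _
  have hεs : stalkScalar X (π.left (σ.left x)) ≫ ε = stalkScalar X x := by
    rw [← stalkScalar_comp σ x, ← stalkScalar_comp π (σ.left x), Category.assoc]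
  have hA : IsLocalRing (U.toScheme.presheaf.stalk ⟨x, hx⟩) := isLocalRing_stalk _ _
  have hB : IsLocalRing (V.toScheme.presheaf.stalk ⟨σ.left x, hy⟩) := isLocalRing_stalk _ _
  let s : U.toScheme.presheaf.stalk ⟨x, hx⟩ ⟶ V.toScheme.presheaf.stalk ⟨σ.left x, hy⟩ :=
    inv u ≫ inv ε ≫ π.left.stalkMap (σ.left x) ≫ v
  let ρ : V.toScheme.presheaf.stalk ⟨σ.left x, hy⟩ ⟶ U.toScheme.presheaf.stalk ⟨x, hx⟩ :=
    inv v ≫ σ.left.stalkMap x ≫ u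
  have hρl : IsLocalHom ρ.hom := by
    have h1 : IsLocalHom (inv v).hom := inferInstance
    have h2 : IsLocalHom (σ.left.stalkMap x).hom := isLocalHom_stalkMap _ _
    have h3 : IsLocalHom u.hom := inferInstance
    exact ⟨fun a ha => isUnit_of_map_unit (inv v).hom a (isUnit_of_map_unit
      (σ.left.stalkMap x).hom _ (isUnit_of_map_unit u.hom _ ha))⟩
  have hsρ : s ≫ ρ = 𝟙 _ := by
    simp only [s, ρ, Category.assoc, IsIso.hom_inv_id_assoc]
    have : inv ε ≫ π.left.stalkMap (σ.left x) ≫ σ.left.stalkMap x = 𝟙 _ := IsIso.inv_hom_id ε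
    rw [reassoc_of% this, IsIso.inv_hom_id]
  have hi' := stalkScalar_comp i ⟨x, hx⟩
  have hj' := stalkScalar_comp j ⟨σ.left x, hy⟩
  have hk : (stalkScalar _ (i.left ⟨x, hx⟩) ≫ i.left.stalkMap ⟨x, hx⟩) ≫ s =
      stalkScalar _ (j.left ⟨σ.left x, hy⟩) ≫ j.left.stalkMap ⟨σ.left x, hy⟩ := by
    rw [hi', hj', ← hs, ← hs', ← stalkScalar_comp π (σ.left x), ← hεs]
    simp [s]
  refine exists_generators_of_stalk_retract
    (A := U.toScheme.presheaf.stalk ⟨x, hx⟩) (B := V.toScheme.presheaf.stalk ⟨σ.left x, hy⟩)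
    _ (j.left ⟨σ.left x, hy⟩)
    (i.left.stalkMap ⟨x, hx⟩) (i.left.stalkMap_surjective _)
    (j.left.stalkMap ⟨σ.left x, hy⟩) (j.left.stalkMap_surjective _)
    s ρ hsρ hk g hg hc

end

/-! ### Jet schemes retract onto the scheme -/

/-- The constant jets `σ : X ⟶ X_m` are a section of the projection `π : X_m ⟶ X` sending a jet to its
value at `t = 0`. -/
theorem exists_retraction_jetScheme {k : Type u} [Field k] (X : Over (Spec (CommRingCat.of k)))
    (m : ℕ) : ∃ (σ : X ⟶ jetScheme m X) (π : jetScheme m X ⟶ X), σ ≫ π = 𝟙 X := by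
  let p := JetScheme.structMap k (TruncPoly k m)
  let e' : TruncPoly k m →ₐ[k] k := AdjoinRoot.liftAlgHom _ (AlgHom.id k k) 0 (by simp)
  let e : Spec (CommRingCat.of k) ⟶ Spec (CommRingCat.of (TruncPoly k m)) :=
    Spec.map (CommRingCat.ofHom e'.toRingHom)
  have he : e ≫ p = 𝟙 _ := by
    rw [← Spec.map_comp, ← CommRingCat.ofHom_comp]
    have : e'.toRingHom.comp (algebraMap k _) = RingHom.id k := e'.comp_algebraMap
    rw [this]
    exact Spec.map_id _
  let ρ : (jetFunctor m X).RepresentableBy (jetScheme m X) := (jetFunctor m X).representableBy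
  let c : (JetScheme.prodFunctor p).obj X ⟶ X :=
    Over.homMk (JetScheme.fst p X) (JetScheme.fst_comp p X)
  let L : (JetScheme.prodFunctor p).obj (jetScheme m X) ⟶ X := ρ.homEquiv (𝟙 _)
  let σ : X ⟶ jetScheme m X := ρ.homEquiv.symm c
  have hσ : (JetScheme.prodFunctor p).map σ ≫ L = c := by
    have := ρ.homEquiv_eq σ
    rw [show ρ.homEquiv σ = c from ρ.homEquiv.apply_symm_apply c] at this
    exact this.symm
  refine ⟨σ, JetScheme.zeroSec e he _ ≫ L, ?_⟩
  rw [JetScheme.zeroSec_naturality_assoc, hσ]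
  ext1
  simp [c]

end LCIRetract

theorem theorem3p5 {k : Type u} [Field k] [IsAlgClosed k]
    (X : Over (Spec (CommRingCat.of k))) [LocallyOfFiniteType X.hom] [QuasiCompact X.hom] (m : ℕ)
    (h : IsLocallyCompleteIntersection (jetScheme m X)) : IsLocallyCompleteIntersection X := by
  obtain ⟨σ, π, hσπ⟩ := LCIRetract.exists_retraction_jetScheme X m
  exact fun x => LCIRetract.isCompleteIntersectionAt_of_retract σ π hσπ x (h _)
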